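/- **Theorem 4.1 (Quadrature Theorem).** Let $\Omega\subset\mathbb R^n$, $n\in\{2,3\}$, be a bounded domain, and let $A(\cdot,\cdot)$ be a Hermitian, coercive and bounded sesquilinear form on the complex space $H^1_0(\Omega)$ with norm $\|\nabla v\|_{L^2(\Omega)}$. Let $(\cdot,\cdot)$ be the $L^2(\Omega)$ inner product, let $L=T^{-1}$, where $T:L^2(\Omega)\to H^1_0(\Omega)$ is the solution operator of $A(Tf,\theta)=(f,\theta)$ for all $\theta\in H^1_0(\Omega)$, and let $\lambda_1>0$ be the smallest eigenvalue of $L$. Let $\mathcal T_h$ be a conforming subdivision of $\overline\Omega$ into finitely many simplexes, $H_h\subset H^1_0(\Omega)$ the space of continuous functions that are affine on each simplex of $\mathcal T_h$, and $L_h:H_h\to H_h$ the operator with $(L_hv,\phi)=A(v,\phi)$ for all $v,\phi\in H_h$. Let $0<\beta<1$, $0<b<\lambda_1/\sqrt2$, $0<d<\pi/4$, and for $t>0$ put $$e^{-tL_h^\beta}v=\sum_j e^{-t\lambda_{j,h}^\beta}(v,\psi_{j,h})\psi_{j,h},$$ where $\{\psi_{j,h}\}$ is an $L^2$-orthonormal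 basis of $H_h$ of eigenvectors of $L_h$ with eigenvalues $\lambda_{j,h}$. For $z\in\mathbb C$ let $$\gamma(z)=b(\cosh z+i\sinh z),\qquad g_\lambda(z,t)=e^{-t\gamma(z)^\beta}(\gamma(z)-\lambda)^{-1}\gamma'(z),$$ with principal powers. For $k>0$, an integer $N\ge1$ and $y_j=jk$ let $$Q_h^{N,k}(t)=\frac{k}{2\pi i}\sum_{j=-N}^{N}e^{-t\gamma(y_j)^\beta}\gamma'(y_j)\,(L_h-\gamma(y_j)I)^{-1}.$$ Finally, let $$\kappa=\cos\big(\beta(\tfrac\pi4+d)\big)\big(\sqrt2\,b\sin(\tfrac\pi4-d)\big)^\beta,\qquad M(t)=1+\mathcal L(\kappa t),\qquad \mathcal L(x)=1+|\ln(1-e^{-x})|,$$ $$N(d,t)=\max_{\lambda\ge\lambda_1}\int_{-\infty}^{\infty}\big(|g_\lambda(y+id,t)|+|g_\lambda(y-id,t)|\big)\,dy .$$ Then $\gamma(y)$ is in the resolvent set of $L_h$ for every $y\in\mathbb R$ (so that $Q_h^{N,k}(t)$ is defined), and there is a constant $C>0$, depending on none of $t$, $k$, $N$ and the subdivision $\mathcal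 T_h$ (in particular not on $h$), such that for all $t>0$, $k>0$ and $N\ge1$ $$\big\|e^{-tL_h^\beta}-Q_h^{N,k}(t)\big\|_{L^2(\Omega)\to L^2(\Omega)}\le C\Big(\frac{N(d,t)}{e^{2\pi d/k}-1}+M(t)\,\frac{\cosh(kN)}{\sinh(kN)}\,e^{-\kappa2^{-\beta}t\,e^{kN\beta}}\Big),$$ the norm being that of operators on $H_h$. Moreover, for every $t>0$ the integrals defining $N(d,t)$ converge and the maximum is attained; $N(d,\cdot)$ is bounded on $[t_0,\infty)$ for every $t_0>0$; and $N(d,t)=O(M(t))$ as $t\to0^+$. -/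

import Mathlib

open scoped ContDiff ComplexConjugate Topology

noncomputable section

namespace SincQuad

/-! ### The complex Sobolev space `H¹₀(Ω)` -/

/-- Euclidean space `ℝⁿ`. -/
abbrev Euc (n : ℕ) : Type := EuclideanSpace ℝ (Fin n)

/-- The complex Hilbert space `L²(Ω)` with Lebesgue measure. -/
abbrev L2 {n : ℕ} (Ω : Set (Euc n)) : Type :=
  MeasureTheory.Lp ℂ 2 (MeasureTheory.volume.restrict Ω)

/-- The Hilbert space `L²(Ω)ⁿ` of square integrable vector fields,
with norm `(∑ i, ‖G i‖²)^(1/2)`. -/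
abbrev L2Vec {n : ℕ} (Ω : Set (Euc n)) : Type :=
  PiLp 2 (fun _ : Fin n => L2 Ω)

/-- The inner product `(x, y)` of a complex Hilbert space, linear in `x` and antilinear in `y`
(Mathlib's `inner ℂ y x`). -/
abbrev ip {E : Type*} [NormedAddCommGroup E] [InnerProductSpace ℂ E] (x y : E) : ℂ :=
  @inner ℂ E InnerProductSpace.toInner y x

/-- The pairs `(φ, ∇φ)`, as elements of `L²(Ω) × L²(Ω)ⁿ`, for `φ ∈ C_c^∞(Ω; ℂ)`. -/
def testGraph {n : ℕ} (Ω : Set (Euc n)) : Set (L2 Ω × L2Vec Ω) :=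
  {p | ∃ φ : Euc n → ℂ, ContDiff ℝ ∞ φ ∧ HasCompactSupport φ ∧ tsupport φ ⊆ Ω ∧
    (p.1 : Euc n → ℂ) =ᵐ[MeasureTheory.volume.restrict Ω] φ ∧
    ∀ i : Fin n, (p.2 i : Euc n → ℂ) =ᵐ[MeasureTheory.volume.restrict Ω]
      fun x => fderiv ℝ φ x (EuclideanSpace.single i (1 : ℝ))}

/-- The pairs `(u, ∇u)` with `u ∈ H¹₀(Ω)`: the closure, in the `H¹` norm, of the pairs
`(φ, ∇φ)` with `φ ∈ C_c^∞(Ω; ℂ)`.  (The set `testGraph Ω` is already a linear subspace, so that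
taking the span only serves to bundle it.) -/
def H10Graph {n : ℕ} (Ω : Set (Euc n)) : Submodule ℂ (L2 Ω × L2Vec Ω) :=
  (Submodule.span ℂ (testGraph Ω)).topologicalClosure

/-- `H¹₀(Ω)`, as a linear subspace of `L²(Ω)`. -/
def H10 {n : ℕ} (Ω : Set (Euc n)) : Submodule ℂ (L2 Ω) :=
  (H10Graph Ω).map (LinearMap.fst ℂ (L2 Ω) (L2Vec Ω))

/-- `G` is the (weak) gradient of `u ∈ H¹₀(Ω)`; in particular `‖u‖_{H¹₀(Ω)} = ‖G‖`. -/
def IsGrad {n : ℕ} {Ω : Set (Euc n)} (u : H10 Ω) (G : L2Vec Ω) : Prop :=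
  ((u : L2 Ω), G) ∈ H10Graph Ω

/-! ### The form `A`, the operator `L` and its smallest eigenvalue -/

/-- A Hermitian, coercive and bounded sesquilinear form on `H¹₀(Ω)`, linear in the first and
antilinear in the second variable.  The norm on `H¹₀(Ω)` is `v ↦ ‖∇v‖_{L²(Ω)}`. -/
structure EllipticForm {n : ℕ} (Ω : Set (Euc n)) where
  /-- the form -/
  form : H10 Ω →ₗ[ℂ] H10 Ω →ₗ⋆[ℂ] ℂ
  hermitian : ∀ v w : H10 Ω, form v w = conj (form w v)
  coercive : ∃ c₀ : ℝ, 0 < c₀ ∧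
    ∀ (v : H10 Ω) (G : L2Vec Ω), IsGrad v G → c₀ * ‖G‖ ^ 2 ≤ (form v v).re
  bounded : ∃ c₁ : ℝ, 0 < c₁ ∧
    ∀ (v w : H10 Ω) (G H : L2Vec Ω), IsGrad v G → IsGrad w H → ‖form v w‖ ≤ c₁ * ‖G‖ * ‖H‖

variable {n : ℕ} {Ω : Set (Euc n)}

/-- `u = T f`, where `T : L²(Ω) → H¹₀(Ω)` is the solution operator of `A(u, θ) = (f, θ)` for all
`θ ∈ H¹₀(Ω)`; equivalently `u ∈ D(L) = Range T` and `L u = f`, since `L = T⁻¹`. -/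
def EllipticForm.LEq (A : EllipticForm Ω) (u : H10 Ω) (f : L2 Ω) : Prop :=
  ∀ θ : H10 Ω, A.form u θ = ip f (θ : L2 Ω)

/-- The set of eigenvalues of the unbounded operator `L`. -/
def EllipticForm.eigenvalues (A : EllipticForm Ω) : Set ℝ :=
  {lam | ∃ u : H10 Ω, u ≠ 0 ∧ A.LEq u ((lam : ℂ) • (u : L2 Ω))}

/-- `λ₁`, the smallest eigenvalue of `L`. -/
def EllipticForm.lam1 (A : EllipticForm Ω) : ℝ := sInf A.eigenvalues

/-! ### Galerkin operators on a finite-dimensional subspace of `H¹₀(Ω)` -/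

section Galerkin

variable (A : EllipticForm Ω) (V : Submodule ℂ (L2 Ω)) [FiniteDimensional ℂ V] (hV : V ≤ H10 Ω)

/-- The operator `L_V : V → V` with `(L_V v, φ) = A(v, φ)` for all `v, φ ∈ V`
(see `inner_galerkinOp`), written out in an orthonormal basis of `V`. -/
def galerkinOp : V →ₗ[ℂ] V :=
  ∑ i, (((A.form.flip (Submodule.inclusion hV (stdOrthonormalBasis ℂ V i))).comp
    (Submodule.inclusion hV)).smulRight (stdOrthonormalBasis ℂ V i) : V →ₗ[ℂ] V)

/-- The defining property of `L_V`. -/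
theorem inner_galerkinOp (v φ : V) :
    ip (galerkinOp A V hV v) φ =
      A.form (Submodule.inclusion hV v) (Submodule.inclusion hV φ) := by
  have h : φ = ∑ i, ip φ (stdOrthonormalBasis ℂ V i) • stdOrthonormalBasis ℂ V i :=
    ((stdOrthonormalBasis ℂ V).sum_repr' φ).symm
  conv_rhs => rw [h]
  simp only [galerkinOp, LinearMap.sum_apply, LinearMap.smulRight_apply, LinearMap.comp_apply,
    LinearMap.flip_apply, inner_sum, inner_smul_right, map_sum, map_smulₛₗ, smul_eq_mul]
  refine Finset.sum_congr rfl fun i _ => ?_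
  rw [RingHom.id_apply, inner_conj_symm, mul_comm]

theorem galerkinOp_isSymmetric : (galerkinOp A V hV).IsSymmetric := by
  intro v w
  have h : conj (ip (galerkinOp A V hV v) w) = ip (galerkinOp A V hV w) v := by
    rw [inner_galerkinOp, inner_galerkinOp, ← A.hermitian]
  rw [← inner_conj_symm]
  exact h

/-- `e^{-t T^β}` for a symmetric operator `T` on `V` with positive eigenvalues:
`v ↦ ∑ j, e^{-t λ_j^β} (v, ψ_j) ψ_j` for an orthonormal basis of eigenvectors `ψ_j` of `T`,
with eigenvalues `λ_j`. -/
def expFrac {T : V →ₗ[ℂ] V} (hT : T.IsSymmetric) (β t : ℝ) : V →ₗ[ℂ] V :=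
  ∑ j, ((Real.exp (-t * hT.eigenvalues rfl j ^ β) : ℝ) : ℂ) •
    ((innerₛₗ ℂ (hT.eigenvectorBasis rfl j)).smulRight (hT.eigenvectorBasis rfl j))

end Galerkin

/-! ### Meshes and continuous piecewise linear finite elements -/

/-- A conforming subdivision of `Ω` made of simplexes: a finite simplicial complex with
underlying space the closure of `Ω`, all of whose maximal simplexes are `n`-dimensional. -/
structure Mesh {n : ℕ} (Ω : Set (Euc n)) where
  /-- the simplicial complex -/
  K : Geometry.SimplicialComplex ℝ (Euc n)
  finite_faces : K.faces.Finite
  space_eq : K.space = closure Ω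
  pure_dim : ∀ s ∈ K.faces, ∃ τ ∈ K.faces, s ⊆ τ ∧ τ.card = n + 1

/-- Continuous functions on the closure of `Ω` (extended by zero to `ℝⁿ`) whose restriction to
every simplex of the mesh is affine. -/
def pwLinear (𝒯 : Mesh Ω) : Submodule ℂ (Euc n → ℂ) where
  carrier := {φ | ContinuousOn φ (closure Ω) ∧ (∀ x, x ∉ closure Ω → φ x = 0) ∧
    ∀ τ ∈ 𝒯.K.faces, ∃ f : Euc n →ᵃ[ℝ] ℂ, Set.EqOn φ f (convexHull ℝ (τ : Set (Euc n)))}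
  zero_mem' := ⟨continuousOn_const, fun _ _ => rfl, fun _ _ => ⟨0, fun _ _ => rfl⟩⟩
  add_mem' := by
    rintro φ ψ ⟨h1, h2, h3⟩ ⟨k1, k2, k3⟩
    refine ⟨h1.add k1, fun x hx => by simp [h2 x hx, k2 x hx], fun τ hτ => ?_⟩
    obtain ⟨f, hf⟩ := h3 τ hτ
    obtain ⟨g, hg⟩ := k3 τ hτ
    exact ⟨f + g, fun x hx => by simp [hf hx, hg hx]⟩
  smul_mem' := by
    rintro c φ ⟨h1, h2, h3⟩
    refine ⟨h1.const_smul c, fun x hx => by simp [h2 x hx], fun τ hτ => ?_⟩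
    obtain ⟨f, hf⟩ := h3 τ hτ
    exact ⟨c • f, fun x hx => by simp [hf hx]⟩

/-- The continuous piecewise linear functions, as elements of `L²(Ω)`. -/
def pwLinearL2 (𝒯 : Mesh Ω) : Submodule ℂ (L2 Ω) where
  carrier := {u | ∃ φ ∈ pwLinear 𝒯, (u : Euc n → ℂ) =ᵐ[MeasureTheory.volume.restrict Ω] φ}
  zero_mem' := ⟨0, zero_mem _, MeasureTheory.Lp.coeFn_zero _ _ _⟩
  add_mem' := by
    rintro u v ⟨φ, hφ, h⟩ ⟨ψ, hψ, k⟩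
    exact ⟨φ + ψ, add_mem hφ hψ, (MeasureTheory.Lp.coeFn_add u v).trans (h.add k)⟩
  smul_mem' := by
    rintro c u ⟨φ, hφ, h⟩
    exact ⟨c • φ, Submodule.smul_mem _ c hφ,
      (MeasureTheory.Lp.coeFn_smul c u).trans (h.const_smul c)⟩

/-- The finite element space `H_h ⊆ H¹₀(Ω)` of continuous piecewise linear functions with
respect to the mesh. -/
def femSpace (𝒯 : Mesh Ω) : Submodule ℂ (L2 Ω) := pwLinearL2 𝒯 ⊓ H10 Ω

theorem femSpace_le (𝒯 : Mesh Ω) : femSpace 𝒯 ≤ H10 Ω := inf_le_right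

/-- A piecewise linear function is determined by its values at the vertices. -/
theorem pwLinear_eq_zero (𝒯 : Mesh Ω) {φ : Euc n → ℂ} (hφ : φ ∈ pwLinear 𝒯)
    (h : ∀ τ ∈ 𝒯.K.faces, ∀ x ∈ τ, φ x = 0) : φ = 0 := by
  obtain ⟨-, h2, h3⟩ := hφ
  funext x
  by_cases hx : x ∈ closure Ω
  · rw [← 𝒯.space_eq, Geometry.SimplicialComplex.mem_space_iff] at hx
    obtain ⟨τ, hτ, hxτ⟩ := hx
    obtain ⟨f, hf⟩ := h3 τ hτ
    have hsub : convexHull ℝ (τ : Set (Euc n)) ⊆ f ⁻¹' {0} := by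
      refine convexHull_min (fun y hy => ?_) ((convex_singleton (0 : ℂ)).affine_preimage f)
      have := hf (subset_convexHull ℝ _ hy)
      simp [← this, h τ hτ y hy]
    rw [hf hxτ]
    exact hsub hxτ
  · exact h2 x hx

instance finiteDimensional_pwLinear (𝒯 : Mesh Ω) : FiniteDimensional ℂ (pwLinear 𝒯) := by
  have hfin : (⋃ τ ∈ 𝒯.K.faces, (τ : Set (Euc n))).Finite :=
    𝒯.finite_faces.biUnion fun τ _ => τ.finite_toSet
  have : Finite (⋃ τ ∈ 𝒯.K.faces, (τ : Set (Euc n)) : Set (Euc n)) := hfin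
  let ev : pwLinear 𝒯 →ₗ[ℂ] ((⋃ τ ∈ 𝒯.K.faces, (τ : Set (Euc n)) : Set (Euc n)) → ℂ) :=
    { toFun := fun φ x => (φ : Euc n → ℂ) x
      map_add' := fun _ _ => rfl
      map_smul' := fun _ _ => rfl }
  refine FiniteDimensional.of_injective ev ((injective_iff_map_eq_zero ev).2 fun φ hφ => ?_)
  refine Subtype.ext (pwLinear_eq_zero 𝒯 φ.2 fun τ hτ x hx => ?_)
  exact congrFun hφ ⟨x, Set.mem_biUnion hτ hx⟩

instance finiteDimensional_pwLinearL2 (𝒯 : Mesh Ω) : FiniteDimensional ℂ (pwLinearL2 𝒯) := by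
  let S : Submodule ℂ (pwLinear 𝒯) :=
    { carrier := {φ | MeasureTheory.MemLp (φ : Euc n → ℂ) 2 (MeasureTheory.volume.restrict Ω)}
      zero_mem' := MeasureTheory.MemLp.zero
      add_mem' := fun h k => MeasureTheory.MemLp.add h k
      smul_mem' := fun c _ h => MeasureTheory.MemLp.const_smul h c }
  let F : S →ₗ[ℂ] L2 Ω :=
    { toFun := fun φ => MeasureTheory.MemLp.toLp ((φ : pwLinear 𝒯) : Euc n → ℂ) φ.2
      map_add' := fun _ _ => rfl
      map_smul' := fun _ _ => rfl }
  refine Submodule.finiteDimensional_of_le (S₂ := LinearMap.range F) ?_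
  rintro u ⟨φ, hφ, hu⟩
  have hmem : MeasureTheory.MemLp φ 2 (MeasureTheory.volume.restrict Ω) :=
    (MeasureTheory.memLp_congr_ae hu).1 (MeasureTheory.Lp.memLp u)
  exact ⟨⟨⟨φ, hφ⟩, hmem⟩, MeasureTheory.Lp.ext ((MeasureTheory.MemLp.coeFn_toLp hmem).trans hu.symm)⟩

instance finiteDimensional_femSpace (𝒯 : Mesh Ω) : FiniteDimensional ℂ (femSpace 𝒯) :=
  Submodule.finiteDimensional_of_le (inf_le_left : femSpace 𝒯 ≤ pwLinearL2 𝒯)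

/-- The finite element operator `L_h : H_h → H_h`, `(L_h v, φ) = A(v, φ)` for `v, φ ∈ H_h`. -/
def Lh (A : EllipticForm Ω) (𝒯 : Mesh Ω) : Module.End ℂ (femSpace 𝒯) :=
  galerkinOp A (femSpace 𝒯) (femSpace_le 𝒯)

/-- The operator `e^{-t L_h^β}` on `H_h`. -/
def expLh (A : EllipticForm Ω) (𝒯 : Mesh Ω) (β t : ℝ) : femSpace 𝒯 →ₗ[ℂ] femSpace 𝒯 :=
  expFrac (femSpace 𝒯) (galerkinOp_isSymmetric A (femSpace 𝒯) (femSpace_le 𝒯)) β t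

/-! ### The contour, the quadrature and the error terms -/

/-- The contour `γ(z) = b (cosh z + i sinh z)`. -/
def hypContour (b : ℝ) (z : ℂ) : ℂ := b * (Complex.cosh z + Complex.I * Complex.sinh z)

/-- The sinc quadrature
`Q_h^{N,k}(t) = k/(2πi) ∑_{j=-N}^{N} e^{-tγ(y_j)^β} γ'(y_j) (L_h - γ(y_j) I)⁻¹`, `y_j = jk`.
Mathlib's `resolvent L z` is `(z I - L)⁻¹`, whence the minus sign.  (As the contour
`y ↦ γ(y)` has the spectrum of `L_h` on its right, Cauchy's formula reads
`e^{-tL_h^β} = (2πi)⁻¹ ∫ e^{-tγ(y)^β} γ'(y) (L_h - γ(y) I)⁻¹ dy`.) -/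
def sincQuad (A : EllipticForm Ω) (𝒯 : Mesh Ω) (β b : ℝ) (N : ℕ) (k t : ℝ) :
    femSpace 𝒯 →ₗ[ℂ] femSpace 𝒯 :=
  ((k : ℂ) / (2 * Real.pi * Complex.I)) • ∑ j ∈ Finset.Icc (-(N : ℤ)) (N : ℤ),
    (Complex.exp (-t * hypContour b ((j : ℂ) * k) ^ (β : ℂ)) *
      deriv (hypContour b) ((j : ℂ) * k)) •
      (-resolvent (Lh A 𝒯) (hypContour b ((j : ℂ) * k)))

/-- `g_λ(z, t) = e^{-tγ(z)^β} (γ(z) - λ)⁻¹ γ'(z)`. -/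
def gFun (β b lam t : ℝ) (z : ℂ) : ℂ :=
  Complex.exp (-t * hypContour b z ^ (β : ℂ)) * (hypContour b z - lam)⁻¹ * deriv (hypContour b) z

/-- The integrand `|g_λ(y + id, t)| + |g_λ(y - id, t)|`. -/
def gLines (β b d lam t y : ℝ) : ℝ :=
  ‖gFun β b lam t (y + d * Complex.I)‖ + ‖gFun β b lam t (y - d * Complex.I)‖

/-- The integrals of which `N(d, t)` is the maximum, one for each `λ ≥ λ₁`. -/
def gIntegrals (β b lam1 d t : ℝ) : Set ℝ :=
  {I | ∃ lam : ℝ, lam1 ≤ lam ∧ I = ∫ y : ℝ, gLines β b d lam t y}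

/-- `N(d, t) = max_{λ ≥ λ₁} ∫ |g_λ(y + id, t)| + |g_λ(y - id, t)| dy`. -/
def Ndt (β b lam1 d t : ℝ) : ℝ := sSup (gIntegrals β b lam1 d t)

/-- `κ = cos(β(π/4 + d)) (√2 b sin(π/4 - d))^β`. -/
def kap (β b d : ℝ) : ℝ :=
  Real.cos (β * (Real.pi / 4 + d)) * (√2 * b * Real.sin (Real.pi / 4 - d)) ^ β

/-- `ℒ(x) = 1 + |ln(1 - e^{-x})|`. -/
def calL (x : ℝ) : ℝ := 1 + |Real.log (1 - Real.exp (-x))|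

/-- `M(t) = 1 + ℒ(κ t)`. -/
def Mt (β b d t : ℝ) : ℝ := 1 + calL (kap β b d * t)

end SincQuad

end

/-!
The operator `e^{-tL_h^β} - Q_h^{N,k}(t)` is diagonal in an orthonormal basis of eigenvectors of
`L_h`, so that its norm is the largest error of the quadrature over the eigenvalues `λ` of `L_h`,
and everything reduces to a scalar estimate that is uniform in `λ ≥ λ₁`.

*The eigenvalues of `L_h` are at least `λ₁`.* As `λ₁` is defined as the infimum of the point
spectrum of `L`, this needs the fact that the Rayleigh quotient of `A` on `H¹₀(Ω)` attains its
infimum (`EllipticForm.exists_isMin`), a consequence of Rellich's theorem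
(`isCompactOperator_fst_H10Graph`). The latter is proved by averaging over small cubes: the error is
controlled by translations, and these by the gradient. In particular no eigenvalue of `L_h` lies on
the contour, which meets the real axis only at `b < λ₁`.

*The scalar estimate.* With `c = √2 b` the contour is `γ(z) = c cosh (z + iπ/4)`. In the strip
`|Im z| ≤ d` it stays in a sector of the right half plane and at a distance at least comparable with
`|γ'|` from `[λ₁, ∞)` (`exists_norm_deriv_hypContour_le`), so that
`|g_λ(z, t)| ≤ K exp (-κ 2^{-β} t e^{β|Re z|})` with `K` independent of `λ` and `t`
(`norm_gFun_le`). Cauchy's formula `integral_gFun` gives `∫ g_λ(y, t) dy = -2πi e^{-tλ^β}`: once the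
pole is split off, the integrand is an odd function of `ζ = z + iπ/4`, holomorphic between the
contour and `Im ζ = 0`. The trapezoidal rule for this integral has an error of at most
`N(d, t) / (e^{2πd/k} - 1)`, by Poisson summation and a shift of the line of integration to
`Im z = ±d` (`norm_integral_sub_tsum_le`), and the terms with `|j| > N` are estimated by the
integral test (`tsum_doubleExp_le`). The integrals of double exponentials that occur are at most a
multiple of `1 + max (-log (κ 2^{-β} t)) 0 ≤ M(t)`, which also yields the bounds for `N(d, t)`.
-/

noncomputable section

namespace SincQuad

open MeasureTheory Filter Set

section Rellich

open scoped ENNReal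

/-! ### Compactness of the embedding of `H¹₀(Ω)` into `L²(Ω)` -/

/-- The Cauchy–Schwarz inequality against the constant `1`. -/
theorem sq_lintegral_le {α : Type*} [MeasurableSpace α] (μ : Measure α) {f : α → ℝ≥0∞}
    (hf : AEMeasurable f μ) : (∫⁻ x, f x ∂μ) ^ 2 ≤ μ univ * ∫⁻ x, f x ^ 2 ∂μ := by
  have h := ENNReal.lintegral_mul_le_Lp_mul_Lq μ Real.HolderConjugate.two_two
    (aemeasurable_const (b := (1 : ℝ≥0∞))) hf
  simp only [Pi.mul_apply, one_mul, one_pow, lintegral_one, ENNReal.rpow_two] at h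
  calc _ ≤ (μ univ ^ (1 / 2 : ℝ) * (∫⁻ x, f x ^ 2 ∂μ) ^ (1 / 2 : ℝ)) ^ 2 := by gcongr
    _ = _ := by
      rw [mul_pow, ← ENNReal.rpow_natCast, ← ENNReal.rpow_natCast, ← ENNReal.rpow_mul,
        ← ENNReal.rpow_mul]
      norm_num

theorem enorm_sub_le_lintegral {n : ℕ} {φ : Euc n → ℂ} (hφ : ContDiff ℝ ∞ φ) (x h : Euc n) :
    ‖φ (x + h) - φ x‖ₑ ≤ ∫⁻ s in Icc (0 : ℝ) 1, ‖fderiv ℝ φ (x + s • h)‖ₑ * ‖h‖ₑ := by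
  have hd : ∀ s : ℝ, HasDerivAt (fun s : ℝ => φ (x + s • h)) (fderiv ℝ φ (x + s • h) h) s := by
    intro s
    have h1 : HasDerivAt (fun s : ℝ => x + s • h) h s := by
      simpa using ((hasDerivAt_id s).smul_const h).const_add x
    exact ((hφ.differentiable (by simp) (x + s • h)).hasFDerivAt).comp_hasDerivAt s h1
  have hc : Continuous fun s : ℝ => fderiv ℝ φ (x + s • h) h :=
    ((hφ.continuous_fderiv (by simp)).comp (by fun_prop)).clm_apply continuous_const
  have := intervalIntegral.integral_eq_sub_of_hasDerivAt (fun s _ => hd s)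
    (hc.intervalIntegrable 0 1)
  simp only [one_smul, zero_smul, add_zero] at this
  rw [← this, intervalIntegral.integral_of_le zero_le_one, ← integral_Icc_eq_integral_Ioc]
  refine (enorm_integral_le_lintegral_enorm _).trans (lintegral_mono fun s => ?_)
  exact ContinuousLinearMap.le_opENorm _ _

/-- A translation by `h` moves a smooth function in `L²` by at most `‖h‖` times the norm of its
gradient. -/
theorem lintegral_enorm_sub_sq_le {n : ℕ} {φ : Euc n → ℂ} (hφ : ContDiff ℝ ∞ φ) (h : Euc n) :
    ∫⁻ x, ‖φ (x + h) - φ x‖ₑ ^ 2 ≤ ‖h‖ₑ ^ 2 * ∫⁻ x, ‖fderiv ℝ φ x‖ₑ ^ 2 := by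
  have hc : Continuous (fderiv ℝ φ) := hφ.continuous_fderiv (by simp)
  have hm : Measurable fun p : Euc n × ℝ => (‖fderiv ℝ φ (p.1 + p.2 • h)‖ₑ * ‖h‖ₑ) ^ 2 := by
    have : Continuous fun p : Euc n × ℝ => fderiv ℝ φ (p.1 + p.2 • h) := hc.comp (by fun_prop)
    exact ((this.enorm.measurable).mul_const _).pow_const _
  calc ∫⁻ x, ‖φ (x + h) - φ x‖ₑ ^ 2
      ≤ ∫⁻ x, ∫⁻ s in Icc (0 : ℝ) 1, (‖fderiv ℝ φ (x + s • h)‖ₑ * ‖h‖ₑ) ^ 2 := by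
        refine lintegral_mono fun x => ?_
        have hm' : Measurable fun s : ℝ => ‖fderiv ℝ φ (x + s • h)‖ₑ * ‖h‖ₑ := by
          have : Continuous fun s : ℝ => fderiv ℝ φ (x + s • h) := hc.comp (by fun_prop)
          exact this.enorm.measurable.mul_const _
        refine (pow_le_pow_left' (enorm_sub_le_lintegral hφ x h) 2).trans ?_
        refine (sq_lintegral_le _ hm'.aemeasurable).trans (le_of_eq ?_)
        simp
    _ = ∫⁻ s in Icc (0 : ℝ) 1, ∫⁻ x, (‖fderiv ℝ φ (x + s • h)‖ₑ * ‖h‖ₑ) ^ 2 :=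
        lintegral_lintegral_swap hm.aemeasurable
    _ = ∫⁻ _ in Icc (0 : ℝ) 1, ‖h‖ₑ ^ 2 * ∫⁻ x, ‖fderiv ℝ φ x‖ₑ ^ 2 := by
        refine lintegral_congr fun s => ?_
        rw [lintegral_add_right_eq_self (fun x => (‖fderiv ℝ φ x‖ₑ * ‖h‖ₑ) ^ 2) (s • h)]
        simp only [mul_pow]
        rw [lintegral_mul_const _ (hc.enorm.measurable.pow_const _), mul_comm]
    _ = _ := by simp

/-- The index of the cube of side `l` of the standard grid that contains `x`. -/
def cellIndex {n : ℕ} (l : ℝ) (x : Euc n) : Fin n → ℤ := fun i => ⌊x i / l⌋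

/-- The cube of side `l` with index `z`. -/
def gridCube {n : ℕ} (l : ℝ) (z : Fin n → ℤ) : Set (Euc n) := {x | cellIndex l x = z}

theorem gridCube_eq {n : ℕ} {l : ℝ} (hl : 0 < l) (z : Fin n → ℤ) :
    gridCube l z = WithLp.ofLp ⁻¹' univ.pi fun i => Ico (z i * l) ((z i + 1) * l) := by
  ext x
  simp only [gridCube, cellIndex, mem_ofPred_eq, funext_iff, mem_preimage, mem_univ_pi, mem_Ico,
    Int.floor_eq_iff, le_div_iff₀ hl, div_lt_iff₀ hl]

theorem measurableSet_gridCube {n : ℕ} {l : ℝ} (hl : 0 < l) (z : Fin n → ℤ) :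
    MeasurableSet (gridCube l z) := by
  rw [gridCube_eq hl]
  exact (PiLp.volume_preserving_ofLp (Fin n)).measurable
    (MeasurableSet.univ_pi fun i => measurableSet_Ico)

theorem volume_gridCube {n : ℕ} {l : ℝ} (hl : 0 < l) (z : Fin n → ℤ) :
    volume (gridCube l z) = ENNReal.ofReal (l ^ n) := by
  rw [gridCube_eq hl, (PiLp.volume_preserving_ofLp (Fin n)).measure_preimage
    (MeasurableSet.univ_pi fun i => measurableSet_Ico).nullMeasurableSet, Real.volume_pi_Ico]
  rw [← ENNReal.ofReal_prod_of_nonneg (by intro i _; nlinarith)]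
  congr 1
  rw [Finset.prod_congr rfl (g := fun _ => l) (by intro i _; ring)]
  simp

/-- The cube of vectors all of whose coordinates are at most `l` in absolute value. -/
def centredCube (n : ℕ) (l : ℝ) : Set (Euc n) :=
  WithLp.ofLp ⁻¹' univ.pi fun _ => Icc (-l) l

theorem measurableSet_centredCube (n : ℕ) (l : ℝ) : MeasurableSet (centredCube n l) :=
  (PiLp.volume_preserving_ofLp (Fin n)).measurable
    (MeasurableSet.univ_pi fun _ => measurableSet_Icc)

theorem volume_centredCube {n : ℕ} {l : ℝ} (hl : 0 < l) :
    volume (centredCube n l) = 2 ^ n * ENNReal.ofReal (l ^ n) := by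
  rw [centredCube, (PiLp.volume_preserving_ofLp (Fin n)).measure_preimage
    (MeasurableSet.univ_pi fun i => measurableSet_Icc).nullMeasurableSet, pi_univ_Icc,
    Real.volume_Icc_pi]
  simp only [sub_neg_eq_add, ← two_mul, Finset.prod_const, Finset.card_univ, Fintype.card_fin]
  rw [ENNReal.ofReal_mul (by norm_num), mul_pow, ENNReal.ofReal_pow hl.le]
  norm_num

theorem norm_sq_le_of_mem_centredCube {n : ℕ} {l : ℝ} {h : Euc n}
    (hh : h ∈ centredCube n l) : ‖h‖ ^ 2 ≤ n * l ^ 2 := by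
  rw [EuclideanSpace.norm_sq_eq]
  calc ∑ i, ‖h i‖ ^ 2 ≤ ∑ _i : Fin n, l ^ 2 := by
        refine Finset.sum_le_sum fun i _ => ?_
        rw [Real.norm_eq_abs, sq_abs]
        have h1 := hh i (mem_univ i)
        exact sq_le_sq' h1.1 h1.2
    _ = _ := by simp

theorem sub_mem_centredCube {n : ℕ} {l : ℝ} (hl : 0 < l) {x y : Euc n}
    (h : cellIndex l y = cellIndex l x) : y - x ∈ centredCube n l := by
  intro i _
  have h1 := congrFun h i
  simp only [cellIndex] at h1
  have h2 := Int.abs_sub_lt_one_of_floor_eq_floor h1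
  rw [← sub_div, abs_div, abs_of_pos hl, div_lt_one hl] at h2
  exact abs_le.1 (by simpa using h2.le)

/-- The mean value of `φ` over the cube with index `z`. -/
def cubeMean {n : ℕ} (l : ℝ) (φ : Euc n → ℂ) (z : Fin n → ℤ) : ℂ := ⨍ y in gridCube l z, φ y

/-- All points of the cube that contains `x` are of the form `x + h` with `h` in the centred cube.
This bounds the deviation of `φ` from its mean value by a quantity without reference to the grid. -/
theorem enorm_sub_cubeMean_sq_le {n : ℕ} {l : ℝ} (hl : 0 < l) {φ : Euc n → ℂ}
    (hφ : Continuous φ) (hφc : HasCompactSupport φ) (x : Euc n) :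
    ‖φ x - cubeMean l φ (cellIndex l x)‖ₑ ^ 2 ≤
      (ENNReal.ofReal (l ^ n))⁻¹ * ∫⁻ h in centredCube n l, ‖φ (x + h) - φ x‖ₑ ^ 2 := by
  set Q := gridCube l (cellIndex l x) with hQ
  set V := ENNReal.ofReal (l ^ n) with hV
  have hVQ : volume Q = V := volume_gridCube hl _
  have hV0 : V ≠ 0 := by rw [hV]; simpa using pow_pos hl n
  have hVt : V ≠ ⊤ := ENNReal.ofReal_ne_top
  have hint : IntegrableOn φ Q := (hφ.integrable_of_hasCompactSupport hφc).integrableOn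
  have hmeas : AEMeasurable (fun y => ‖φ y - φ x‖ₑ) (volume.restrict Q) :=
    (by fun_prop : Continuous fun y => ‖φ y - φ x‖ₑ).measurable.aemeasurable
  have h1 : cubeMean l φ (cellIndex l x) - φ x = ⨍ y in Q, (φ y - φ x) := by
    rw [cubeMean, setAverage_eq, setAverage_eq, integral_sub hint
      (integrableOn_const (by rw [hVQ]; exact hVt)), setIntegral_const, smul_sub, smul_smul,
      inv_mul_cancel₀, one_smul]
    rw [measureReal_def, hVQ]
    exact (ENNReal.toReal_pos hV0 hVt).ne'
  have h2 : ‖φ x - cubeMean l φ (cellIndex l x)‖ₑ ≤ V⁻¹ * ∫⁻ y in Q, ‖φ y - φ x‖ₑ := by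
    rw [← enorm_neg, neg_sub, h1, setAverage_eq, enorm_smul, measureReal_def, hVQ]
    refine mul_le_mul' (le_of_eq ?_) (enorm_integral_le_lintegral_enorm _)
    rw [← ENNReal.toReal_inv, Real.enorm_of_nonneg ENNReal.toReal_nonneg,
      ENNReal.ofReal_toReal (ENNReal.inv_ne_top.2 hV0)]
  calc _ ≤ (V⁻¹ * ∫⁻ y in Q, ‖φ y - φ x‖ₑ) ^ 2 := by gcongr
    _ ≤ V⁻¹ ^ 2 * (V * ∫⁻ y in Q, ‖φ y - φ x‖ₑ ^ 2) := by
        rw [mul_pow]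
        gcongr
        refine (sq_lintegral_le _ hmeas).trans (le_of_eq ?_)
        rw [Measure.restrict_apply_univ, hVQ]
    _ = V⁻¹ * ∫⁻ y in Q, ‖φ y - φ x‖ₑ ^ 2 := by
        rw [sq, ← mul_assoc, mul_assoc V⁻¹, ENNReal.inv_mul_cancel hV0 hVt, mul_one]
    _ ≤ _ := by
        gcongr V⁻¹ * ?_
        rw [← lintegral_indicator (measurableSet_gridCube hl _),
          ← lintegral_indicator (measurableSet_centredCube n l),
          ← lintegral_add_left_eq_self _ x]
        refine lintegral_mono fun h => ?_
        by_cases hh : x + h ∈ Q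
        · have h3 : h ∈ centredCube n l := by
            have := sub_mem_centredCube hl (x := x) (y := x + h) hh
            simpa using this
          rw [indicator_of_mem hh, indicator_of_mem h3]
        · rw [indicator_of_notMem hh]; exact zero_le

/-- Approximation of a test function by its mean values over the cubes of side `l`. -/
theorem lintegral_enorm_sub_cubeMean_sq_le {n : ℕ} {l : ℝ} (hl : 0 < l) {φ : Euc n → ℂ}
    (hφ : ContDiff ℝ ∞ φ) (hφc : HasCompactSupport φ) :
    ∫⁻ x, ‖φ x - cubeMean l φ (cellIndex l x)‖ₑ ^ 2 ≤
      2 ^ n * ENNReal.ofReal (n * l ^ 2) * ∫⁻ x, ‖fderiv ℝ φ x‖ₑ ^ 2 := by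
  set V := ENNReal.ofReal (l ^ n) with hV
  have hV0 : V ≠ 0 := by rw [hV]; simpa using pow_pos hl n
  have hVt : V ≠ ⊤ := ENNReal.ofReal_ne_top
  set D := ∫⁻ x, ‖fderiv ℝ φ x‖ₑ ^ 2
  have hc := hφ.continuous
  have hm : Measurable fun p : Euc n × Euc n => ‖φ (p.1 + p.2) - φ p.1‖ₑ ^ 2 :=
    Measurable.pow_const (Continuous.measurable (by fun_prop)) _
  calc _ ≤ ∫⁻ x, V⁻¹ * ∫⁻ h in centredCube n l, ‖φ (x + h) - φ x‖ₑ ^ 2 :=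
        lintegral_mono fun x => enorm_sub_cubeMean_sq_le hl hc hφc x
    _ = V⁻¹ * ∫⁻ h in centredCube n l, ∫⁻ x, ‖φ (x + h) - φ x‖ₑ ^ 2 := by
        rw [lintegral_const_mul' _ _ (ENNReal.inv_ne_top.2 hV0),
          lintegral_lintegral_swap hm.aemeasurable]
    _ ≤ V⁻¹ * ∫⁻ _ in centredCube n l, ENNReal.ofReal (n * l ^ 2) * D := by
        gcongr V⁻¹ * ?_
        refine setLIntegral_mono' (measurableSet_centredCube n l) fun h hh => ?_
        refine (lintegral_enorm_sub_sq_le hφ h).trans ?_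
        gcongr
        rw [← ofReal_norm, ← ENNReal.ofReal_pow (norm_nonneg _)]
        exact ENNReal.ofReal_le_ofReal (norm_sq_le_of_mem_centredCube hh)
    _ = (V⁻¹ * V) * (2 ^ n * ENNReal.ofReal (n * l ^ 2) * D) := by
        rw [setLIntegral_const, volume_centredCube hl]; ring
    _ = _ := by rw [ENNReal.inv_mul_cancel hV0 hVt, one_mul]

theorem opNorm_sq_le_sum {n : ℕ} (T : Euc n →L[ℝ] ℂ) :
    ‖T‖ ^ 2 ≤ ∑ i, ‖T (EuclideanSpace.single i (1 : ℝ))‖ ^ 2 := by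
  set S := ∑ i, ‖T (EuclideanSpace.single i (1 : ℝ))‖ ^ 2
  have hS : 0 ≤ S := Finset.sum_nonneg fun i _ => sq_nonneg _
  have h : ‖T‖ ≤ √S := by
    refine T.opNorm_le_bound (Real.sqrt_nonneg _) fun x => ?_
    have hx : T x = ∑ i, x i • T (EuclideanSpace.single i (1 : ℝ)) := by
      conv_lhs => rw [← (EuclideanSpace.basisFun (Fin n) ℝ).sum_repr x]
      simp
    calc ‖T x‖ ≤ ∑ i, ‖T (EuclideanSpace.single i (1 : ℝ))‖ * ‖x i‖ := by
          rw [hx]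
          refine (norm_sum_le _ _).trans (Finset.sum_le_sum fun i _ => ?_)
          rw [norm_smul, mul_comm]
      _ ≤ √S * √(∑ i, ‖x i‖ ^ 2) := Real.sum_mul_le_sqrt_mul_sqrt _ _ _
      _ = √S * ‖x‖ := by rw [EuclideanSpace.norm_eq]
  calc ‖T‖ ^ 2 ≤ √S ^ 2 := by gcongr
    _ = S := Real.sq_sqrt hS

theorem enorm_Lp_sq {α : Type*} [MeasurableSpace α] {μ : Measure α} (u : Lp ℂ 2 μ) :
    ‖u‖ₑ ^ 2 = ∫⁻ x, ‖u x‖ₑ ^ 2 ∂μ := by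
  rw [Lp.enorm_def, eLpNorm_eq_lintegral_rpow_enorm_toReal two_ne_zero ENNReal.ofNat_ne_top]
  rw [← ENNReal.rpow_natCast, ← ENNReal.rpow_mul]
  simp

/-- The Dirichlet integral of a test function is at most the norm of its gradient in `L²(Ω)ⁿ`. -/
theorem lintegral_fderiv_sq_le {n : ℕ} {Ω : Set (Euc n)} {φ : Euc n → ℂ} {G : L2Vec Ω}
    (hφ : ContDiff ℝ ∞ φ) (hs : tsupport φ ⊆ Ω)
    (hG : ∀ i : Fin n, (G i : Euc n → ℂ) =ᵐ[volume.restrict Ω]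
      fun x => fderiv ℝ φ x (EuclideanSpace.single i (1 : ℝ))) :
    ∫⁻ x, ‖fderiv ℝ φ x‖ₑ ^ 2 ≤ ‖G‖ₑ ^ 2 := by
  have hc : Continuous (fderiv ℝ φ) := hφ.continuous_fderiv (by simp)
  have h0 : Function.support (fun x => ‖fderiv ℝ φ x‖ₑ ^ 2) ⊆ Ω := by
    intro x hx
    refine hs (support_fderiv_subset ℝ ?_)
    intro h
    refine hx ?_
    simp only
    rw [h, ← ofReal_norm, norm_zero]
    simp
  rw [← setLIntegral_eq_of_support_subset h0]
  calc ∫⁻ x in Ω, ‖fderiv ℝ φ x‖ₑ ^ 2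
      ≤ ∫⁻ x in Ω, ∑ i, ‖fderiv ℝ φ x (EuclideanSpace.single i (1 : ℝ))‖ₑ ^ 2 := by
        refine lintegral_mono fun x => ?_
        have := ENNReal.ofReal_le_ofReal (opNorm_sq_le_sum (fderiv ℝ φ x))
        rw [ENNReal.ofReal_sum_of_nonneg (fun i _ => sq_nonneg _)] at this
        simpa only [ENNReal.ofReal_pow (norm_nonneg _), ofReal_norm] using this
    _ = ∑ i, ∫⁻ x in Ω, ‖fderiv ℝ φ x (EuclideanSpace.single i (1 : ℝ))‖ₑ ^ 2 :=
        lintegral_finsetSum _ fun i _ =>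
          ((hc.clm_apply continuous_const).enorm.measurable).pow_const _
    _ = ∑ i, ‖G i‖ₑ ^ 2 := by
        refine Finset.sum_congr rfl fun i _ => ?_
        rw [enorm_Lp_sq]
        refine lintegral_congr_ae ((hG i).mono fun x hx => ?_)
        simp only [hx]
    _ = ‖G‖ₑ ^ 2 := by
        rw [← ofReal_norm G, ← ENNReal.ofReal_pow (norm_nonneg _), PiLp.norm_sq_eq_of_L2,
          ENNReal.ofReal_sum_of_nonneg (fun i _ => sq_nonneg _)]
        simp only [ENNReal.ofReal_pow (norm_nonneg _), ofReal_norm]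

theorem finite_cellIndex_image {n : ℕ} {l : ℝ} (hl : 0 < l) {Ω : Set (Euc n)}
    (hΩ : Bornology.IsBounded Ω) : (cellIndex l '' Ω).Finite := by
  obtain ⟨R, hR⟩ := hΩ.exists_norm_le
  refine (Set.Finite.pi' (t := fun _ : Fin n => Icc ⌊-R / l⌋ ⌊R / l⌋)
    fun _ => finite_Icc _ _).subset ?_
  rintro _ ⟨x, hx, rfl⟩ i
  have h1 : |x i| ≤ R := (PiLp.norm_apply_le x i).trans (hR x hx)
  have h2 := abs_le.1 h1
  exact ⟨Int.floor_le_floor (by gcongr; exact h2.1), Int.floor_le_floor (by gcongr; exact h2.2)⟩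

theorem coeFn_sum {α ι : Type*} [MeasurableSpace α] {μ : Measure α} (s : Finset ι)
    (f : ι → Lp ℂ 2 μ) : ∀ᵐ x ∂μ, (∑ i ∈ s, f i : Lp ℂ 2 μ) x = ∑ i ∈ s, f i x := by
  classical
  induction s using Finset.induction_on with
  | empty =>
    filter_upwards [Lp.coeFn_zero ℂ 2 μ] with x hx
    simpa using hx
  | insert a s ha ih =>
    rw [Finset.sum_insert ha]
    filter_upwards [ih, Lp.coeFn_add (f a) (∑ i ∈ s, f i)] with x h1 h2
    rw [h2, Pi.add_apply, h1, Finset.sum_insert ha]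

/-- Test functions are approximated in `L²(Ω)` by step functions, with an error controlled by the
gradient. -/
theorem exists_finiteDimensional_approx {n : ℕ} {Ω : Set (Euc n)} (hΩo : IsOpen Ω)
    (hΩ : Bornology.IsBounded Ω)
    {ε : ℝ} (hε : 0 < ε) :
    ∃ W : Submodule ℂ (L2 Ω), FiniteDimensional ℂ W ∧
      ∀ p ∈ testGraph Ω, ∃ w ∈ W, ‖p.1 - w‖ ≤ ε * ‖p.2‖ := by
  -- the factor `2 ^ n * (n * l ^ 2)` is the one of `lintegral_enorm_sub_cubeMean_sq_le`
  obtain ⟨l, hl, hlε⟩ : ∃ l : ℝ, 0 < l ∧ 2 ^ n * (n * l ^ 2) ≤ ε ^ 2 := by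
    have h0 : (0 : ℝ) < 2 ^ n * (n + 1) := by positivity
    refine ⟨ε / √(2 ^ n * (n + 1)), by positivity, ?_⟩
    rw [div_pow, Real.sq_sqrt h0.le, ← mul_assoc, mul_div_assoc', div_le_iff₀ h0]
    nlinarith [sq_nonneg ε, pow_pos (two_pos : (0 : ℝ) < 2) n,
      mul_nonneg (sq_nonneg ε) (pow_pos (two_pos : (0 : ℝ) < 2) n).le]
  have hfin := finite_cellIndex_image hl hΩ
  have hμ : ∀ z, (volume.restrict Ω) (gridCube l z) ≠ ⊤ := fun z =>
    ((Measure.restrict_apply_le _ _).trans_lt (by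
      rw [volume_gridCube hl]; exact ENNReal.ofReal_lt_top)).ne
  set e : (Fin n → ℤ) → L2 Ω := fun z =>
    indicatorConstLp 2 (measurableSet_gridCube hl z) (hμ z) (1 : ℂ) with he
  refine ⟨Submodule.span ℂ (e '' (cellIndex l '' Ω)),
    FiniteDimensional.span_of_finite ℂ (hfin.image e), ?_⟩
  rintro ⟨u, G⟩ ⟨φ, hφ, hφc, hs, hu, hG⟩
  refine ⟨∑ z ∈ hfin.toFinset, cubeMean l φ z • e z,
    Submodule.sum_mem _ fun z hz => Submodule.smul_mem _ _ (Submodule.subset_span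
      (mem_image_of_mem e (hfin.mem_toFinset.1 hz))), ?_⟩
  set w : L2 Ω := ∑ z ∈ hfin.toFinset, cubeMean l φ z • e z with hw
  have hez : ∀ z, (e z : Euc n → ℂ) =ᵐ[volume.restrict Ω] (gridCube l z).indicator fun _ => 1 :=
    fun z => indicatorConstLp_coeFn
  have hwae : ∀ᵐ x ∂volume.restrict Ω, w x = cubeMean l φ (cellIndex l x) := by
    have h1 := coeFn_sum hfin.toFinset fun z => (cubeMean l φ z • e z : L2 Ω)
    have h2 : ∀ᵐ x ∂volume.restrict Ω, ∀ z ∈ hfin.toFinset, (cubeMean l φ z • e z : L2 Ω) x =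
        cubeMean l φ z * (gridCube l z).indicator (fun _ => (1 : ℂ)) x := by
      rw [Filter.eventually_all_finset]
      intro z _
      filter_upwards [Lp.coeFn_smul (cubeMean l φ z) (e z), hez z] with x hx1 hx2
      rw [hx1, Pi.smul_apply, hx2, smul_eq_mul]
    filter_upwards [h1, h2, ae_restrict_mem hΩo.measurableSet] with x hx1 hx2 hxΩ
    rw [hx1, Finset.sum_congr rfl hx2, Finset.sum_eq_single (cellIndex l x)]
    · have : x ∈ gridCube l (cellIndex l x) := rfl
      rw [indicator_of_mem this, mul_one]
    · intro z _ hz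
      have : x ∉ gridCube l z := fun h => hz (Eq.symm h)
      rw [indicator_of_notMem this, mul_zero]
    · intro h
      exact absurd (hfin.mem_toFinset.2 (mem_image_of_mem _ hxΩ)) h
  have hmain : ‖u - w‖ₑ ^ 2 ≤ ENNReal.ofReal (ε ^ 2) * ‖G‖ₑ ^ 2 := by
    calc ‖u - w‖ₑ ^ 2 = ∫⁻ x in Ω, ‖φ x - cubeMean l φ (cellIndex l x)‖ₑ ^ 2 := by
          rw [enorm_Lp_sq]
          refine lintegral_congr_ae ?_
          filter_upwards [Lp.coeFn_sub u w, hu, hwae] with x h1 h2 h3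
          simp only [h1, Pi.sub_apply, h2, h3]
      _ ≤ ∫⁻ x, ‖φ x - cubeMean l φ (cellIndex l x)‖ₑ ^ 2 :=
          lintegral_mono' Measure.restrict_le_self le_rfl
      _ ≤ 2 ^ n * ENNReal.ofReal (n * l ^ 2) * ∫⁻ x, ‖fderiv ℝ φ x‖ₑ ^ 2 :=
          lintegral_enorm_sub_cubeMean_sq_le hl hφ hφc
      _ ≤ ENNReal.ofReal (ε ^ 2) * ‖G‖ₑ ^ 2 := by
          refine mul_le_mul' ?_ (lintegral_fderiv_sq_le hφ hs hG)
          have h2 : (2 : ℝ≥0∞) ^ n = ENNReal.ofReal (2 ^ n) := by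
            rw [ENNReal.ofReal_pow (by norm_num)]; norm_num
          rw [h2, ← ENNReal.ofReal_mul (by positivity)]
          exact ENNReal.ofReal_le_ofReal hlε
  rw [← ofReal_norm, ← ofReal_norm, ← ENNReal.ofReal_pow (norm_nonneg _),
    ← ENNReal.ofReal_pow (norm_nonneg _), ← ENNReal.ofReal_mul (by positivity),
    ENNReal.ofReal_le_ofReal_iff (by positivity), ← mul_pow] at hmain
  exact abs_le_of_sq_le_sq' hmain (by positivity) |>.2

theorem zero_mem_testGraph {n : ℕ} (Ω : Set (Euc n)) : (0 : L2 Ω × L2Vec Ω) ∈ testGraph Ω := by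
  refine ⟨0, contDiff_const, HasCompactSupport.zero, by simp [tsupport_eq_empty_iff.2],
    Lp.coeFn_zero _ _ _, fun i => ?_⟩
  filter_upwards [Lp.coeFn_zero ℂ 2 (volume.restrict Ω)] with x hx
  simpa using hx

theorem add_mem_testGraph {n : ℕ} {Ω : Set (Euc n)} {p q : L2 Ω × L2Vec Ω}
    (hp : p ∈ testGraph Ω) (hq : q ∈ testGraph Ω) : p + q ∈ testGraph Ω := by
  obtain ⟨φ, h1, h2, h3, h4, h5⟩ := hp
  obtain ⟨ψ, k1, k2, k3, k4, k5⟩ := hq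
  refine ⟨φ + ψ, h1.add k1, h2.add k2, (tsupport_add φ ψ).trans (union_subset h3 k3),
    (Lp.coeFn_add _ _).trans (h4.add k4), fun i => ?_⟩
  filter_upwards [Lp.coeFn_add (p.2 i) (q.2 i), h5 i, k5 i] with x hx1 hx2 hx3
  have : (p + q).2 i = p.2 i + q.2 i := rfl
  rw [this, hx1, Pi.add_apply, hx2, hx3, fderiv_add (h1.differentiable (by simp) x)
    (k1.differentiable (by simp) x)]
  rfl

theorem smul_mem_testGraph {n : ℕ} {Ω : Set (Euc n)} {p : L2 Ω × L2Vec Ω} (c : ℂ)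
    (hp : p ∈ testGraph Ω) : c • p ∈ testGraph Ω := by
  obtain ⟨φ, h1, h2, h3, h4, h5⟩ := hp
  refine ⟨c • φ, h1.const_smul c, h2.smul_left (f := fun _ => c),
    (tsupport_smul_subset_right (fun _ => c) φ).trans h3,
    (Lp.coeFn_smul _ _).trans (h4.const_smul c), fun i => ?_⟩
  filter_upwards [Lp.coeFn_smul c (p.2 i), h5 i] with x hx1 hx2
  have : (c • p).2 i = c • p.2 i := rfl
  rw [this, hx1, Pi.smul_apply, hx2, fderiv_const_smul (h1.differentiable (by simp) x)]
  rfl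

theorem span_testGraph {n : ℕ} (Ω : Set (Euc n)) :
    (Submodule.span ℂ (testGraph Ω) : Set (L2 Ω × L2Vec Ω)) = testGraph Ω := by
  refine Subset.antisymm (fun p hp => ?_) Submodule.subset_span
  exact Submodule.span_induction (p := fun p _ => p ∈ testGraph Ω) (fun _ h => h)
    (zero_mem_testGraph Ω) (fun _ _ _ _ h k => add_mem_testGraph h k)
    (fun c _ _ h => smul_mem_testGraph c h) hp

/-- An operator whose values are approximated, uniformly on the unit ball, by elements of finite
dimensional subspaces is the limit of its compositions with the orthogonal projections onto these
subspaces, and therefore compact. -/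
theorem isCompactOperator_of_finiteDimensional_approx {X E : Type*} [NormedAddCommGroup X]
    [NormedSpace ℂ X] [NormedAddCommGroup E] [InnerProductSpace ℂ E] [CompleteSpace E]
    (T : X →L[ℂ] E)
    (h : ∀ ε : ℝ, 0 < ε → ∃ W : Submodule ℂ E, FiniteDimensional ℂ W ∧
      ∀ x, ∃ w ∈ W, ‖T x - w‖ ≤ ε * ‖x‖) : IsCompactOperator T := by
  have hclosed : IsClosed {S : X →L[ℂ] E | IsCompactOperator S} :=
    isClosed_setOfPred_isCompactOperator
  refine hclosed.closure_subset (Metric.mem_closure_iff.2 fun ε hε => ?_)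
  obtain ⟨W, hW, happ⟩ := h (ε / 2) (half_pos hε)
  refine ⟨W.starProjection ∘L T, ?_, ?_⟩
  · have := FiniteDimensional.proper ℂ W
    have h1 : IsCompactOperator W.orthogonalProjectionOnto :=
      isCompactOperator_of_locallyCompactSpace_dom W.orthogonalProjectionOnto
    exact (h1.comp_clm T).clm_comp W.subtypeL
  · rw [dist_eq_norm]
    refine lt_of_le_of_lt (ContinuousLinearMap.opNorm_le_bound _ (half_pos hε).le fun x => ?_)
      (half_lt_self hε)
    obtain ⟨w, hw, hle⟩ := happ x
    refine le_trans ?_ hle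
    have h2 := W.starProjection_minimal (T x)
    refine (le_of_eq h2).trans ?_
    exact ciInf_le (f := fun y : W => ‖T x - y‖) ⟨0, by rintro _ ⟨y, rfl⟩; positivity⟩ ⟨w, hw⟩

/-- **Rellich's theorem**: the embedding `(u, ∇u) ↦ u` of `H¹₀(Ω)` into `L²(Ω)` is compact, being
the limit of its compositions with projections onto spaces of step functions. -/
theorem isCompactOperator_fst_H10Graph {n : ℕ} {Ω : Set (Euc n)} (hΩo : IsOpen Ω)
    (hΩ : Bornology.IsBounded Ω) :
    IsCompactOperator (ContinuousLinearMap.fst ℂ (L2 Ω) (L2Vec Ω) ∘L (H10Graph Ω).subtypeL) := by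
  refine isCompactOperator_of_finiteDimensional_approx _ fun ε hε => ?_
  obtain ⟨W, hW, happ⟩ := exists_finiteDimensional_approx hΩo hΩ hε
  have hle : ∀ p ∈ H10Graph Ω, ‖p.1 - W.starProjection p.1‖ ≤ ε * ‖p.2‖ := by
    intro p hp
    have hcl : IsClosed {p : L2 Ω × L2Vec Ω | ‖p.1 - W.starProjection p.1‖ ≤ ε * ‖p.2‖} :=
      isClosed_le (by fun_prop) (by fun_prop)
    refine hcl.closure_subset_iff.2 (fun q hq => ?_) hp
    have hq' : q ∈ testGraph Ω := by rw [← span_testGraph]; exact hq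
    obtain ⟨w, hw, hqw⟩ := happ q hq'
    refine le_trans ?_ hqw
    refine (le_of_eq (W.starProjection_minimal q.1)).trans ?_
    exact ciInf_le (f := fun y : W => ‖q.1 - y‖) ⟨0, by rintro _ ⟨y, rfl⟩; positivity⟩ ⟨w, hw⟩
  refine ⟨W, hW, fun p => ⟨W.starProjection (p : L2 Ω × L2Vec Ω).1,
    W.starProjection_apply_mem _, (hle p p.2).trans ?_⟩⟩
  gcongr
  exact le_max_right ‖(p : L2 Ω × L2Vec Ω).1‖ ‖(p : L2 Ω × L2Vec Ω).2‖

end Rellich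

/-! ### The smallest eigenvalue and the Rayleigh quotient -/

section Rayleigh

variable {n : ℕ} {Ω : Set (Euc n)}

/-- The quadratic form `v ↦ A(v, v)`. -/
def EllipticForm.quad (A : EllipticForm Ω) (v : H10 Ω) : ℝ := (A.form v v).re

theorem EllipticForm.quad_add (A : EllipticForm Ω) (v w : H10 Ω) :
    A.quad (v + w) = A.quad v + 2 * (A.form v w).re + A.quad w := by
  have h : (A.form w v).re = (A.form v w).re := by rw [A.hermitian w v, Complex.conj_re]
  simp only [EllipticForm.quad, map_add, LinearMap.add_apply, Complex.add_re, h]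
  ring

theorem EllipticForm.quad_smul (A : EllipticForm Ω) (c : ℂ) (v : H10 Ω) :
    A.quad (c • v) = ‖c‖ ^ 2 * A.quad v := by
  simp only [EllipticForm.quad, map_smul, map_smulₛₗ, LinearMap.smul_apply, smul_eq_mul]
  rw [← mul_assoc, ← Complex.normSq_eq_conj_mul_self, Complex.re_ofReal_mul,
    Complex.normSq_eq_norm_sq]

theorem exists_isGrad (v : H10 Ω) : ∃ G, IsGrad v G := by
  obtain ⟨v, p, hp, rfl⟩ := v
  exact ⟨p.2, hp⟩

theorem EllipticForm.quad_nonneg (A : EllipticForm Ω) (v : H10 Ω) : 0 ≤ A.quad v := by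
  obtain ⟨c₀, hc₀, h⟩ := A.coercive
  obtain ⟨G, hG⟩ := exists_isGrad v
  exact le_trans (by positivity) (h v G hG)

theorem EllipticForm.eigenvalues_nonneg (A : EllipticForm Ω) {lam : ℝ}
    (h : lam ∈ A.eigenvalues) : 0 ≤ lam := by
  obtain ⟨u, hu, hA⟩ := h
  have h1 := A.quad_nonneg u
  have h3 : (inner ℂ (u : L2 Ω) (u : L2 Ω)).re = ‖(u : L2 Ω)‖ ^ 2 :=
    inner_self_eq_norm_sq (𝕜 := ℂ) _
  rw [EllipticForm.quad, hA u, ip, inner_smul_right, Complex.re_ofReal_mul, h3] at h1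
  have h2 : 0 < ‖(u : L2 Ω)‖ := norm_pos_iff.2 (by simpa using hu)
  exact le_of_mul_le_mul_right (by simpa using h1) (pow_pos h2 2)

/-- A minimizer of the Rayleigh quotient is an eigenvector, since the form
`A(v, w) - μ (v, w)` is nonnegative and vanishes at it. -/
theorem EllipticForm.leq_of_isMin (A : EllipticForm Ω) {μ : ℝ} {u : H10 Ω}
    (hμ : ∀ v : H10 Ω, μ * ‖(v : L2 Ω)‖ ^ 2 ≤ A.quad v)
    (hu : A.quad u ≤ μ * ‖(u : L2 Ω)‖ ^ 2) : A.LEq u ((μ : ℂ) • (u : L2 Ω)) := by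
  have key : ∀ θ : H10 Ω, (A.form u θ).re = μ * (inner ℂ (θ : L2 Ω) (u : L2 Ω)).re := by
    intro θ
    set r := (A.form u θ).re - μ * (inner ℂ (θ : L2 Ω) (u : L2 Ω)).re with hr
    set q := A.quad θ - μ * ‖(θ : L2 Ω)‖ ^ 2
    have hquad : ∀ s : ℝ, 0 ≤ 2 * s * r + s ^ 2 * q := by
      intro s
      have h1 := hμ (u + (s : ℂ) • θ)
      have h2 := norm_add_sq (𝕜 := ℂ) (u : L2 Ω) ((s : ℂ) • (θ : L2 Ω))
      have h3 : (A.form u ((s : ℂ) • θ)).re = s * (A.form u θ).re := by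
        rw [map_smulₛₗ, Complex.conj_ofReal, smul_eq_mul, Complex.re_ofReal_mul]
      have h4 : (inner ℂ (u : L2 Ω) (θ : L2 Ω)).re = (inner ℂ (θ : L2 Ω) (u : L2 Ω)).re := by
        rw [← inner_conj_symm, Complex.conj_re]
      rw [A.quad_add, A.quad_smul, h3, Submodule.coe_add, Submodule.coe_smul, h2, norm_smul,
        inner_smul_right] at h1
      simp only [Complex.norm_real, Real.norm_eq_abs, sq_abs, mul_pow] at h1
      have h5 : RCLike.re ((s : ℂ) * inner ℂ (u : L2 Ω) (θ : L2 Ω)) =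
          s * (inner ℂ (θ : L2 Ω) (u : L2 Ω)).re := by
        rw [← h4]; exact Complex.re_ofReal_mul _ _
      rw [h5] at h1
      simp only [hr, q]
      nlinarith
    -- the quadratic polynomial `2 r s + q s²` takes a negative value near `s = 0` unless `r = 0`
    by_contra hne
    have hr0 : r ≠ 0 := fun h => hne (by linarith)
    have h1 := hquad (-r / (|q| + 1))
    have hq1 : 0 < |q| + 1 := by positivity
    have h2 : 2 * (-r / (|q| + 1)) * r + (-r / (|q| + 1)) ^ 2 * q =
        r ^ 2 / (|q| + 1) ^ 2 * (q - 2 * (|q| + 1)) := by field_simp; ring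
    rw [h2] at h1
    have h3 : 0 < r ^ 2 / (|q| + 1) ^ 2 := by positivity
    nlinarith [le_abs_self q, abs_nonneg q]
  intro θ
  rw [ip, inner_smul_right]
  apply Complex.ext
  · rw [Complex.re_ofReal_mul]; exact key θ
  -- the imaginary part is the real part for the vector `i θ`
  · have h := key (Complex.I • θ)
    rw [map_smulₛₗ, Submodule.coe_smul, inner_smul_left] at h
    rw [Complex.im_ofReal_mul]
    simpa using h

/-- The infimum of the Rayleigh quotient is attained: along a minimizing sequence that converges in
`L²(Ω)` the parallelogram law for `A` shows that the gradients form a Cauchy sequence. -/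
theorem EllipticForm.exists_isMin (A : EllipticForm Ω) (hΩo : IsOpen Ω)
    (hΩb : Bornology.IsBounded Ω) {v₀ : H10 Ω} (hv₀ : v₀ ≠ 0) :
    ∃ (μ : ℝ) (u : H10 Ω), u ≠ 0 ∧ (∀ v : H10 Ω, μ * ‖(v : L2 Ω)‖ ^ 2 ≤ A.quad v) ∧
      A.quad u ≤ μ * ‖(u : L2 Ω)‖ ^ 2 := by
  obtain ⟨c₀, hc₀, hcoer⟩ := A.coercive
  obtain ⟨c₁, hc₁, hbdd⟩ := A.bounded
  set S : Set ℝ := {r | ∃ v : H10 Ω, ‖(v : L2 Ω)‖ = 1 ∧ A.quad v = r} with hS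
  have hnorm : ∀ v : H10 Ω, v ≠ 0 → ‖(((‖(v : L2 Ω)‖⁻¹ : ℝ) : ℂ) • v : H10 Ω).1‖ = 1 := by
    intro v hv
    have : ‖(v : L2 Ω)‖ ≠ 0 := norm_ne_zero_iff.2 (by simpa using hv)
    rw [Submodule.coe_smul, norm_smul, Complex.norm_real, norm_inv, norm_norm,
      inv_mul_cancel₀ this]
  have hSne : S.Nonempty := ⟨_, _, hnorm v₀ hv₀, rfl⟩
  have hSb : BddBelow S := ⟨0, by rintro _ ⟨v, -, rfl⟩; exact A.quad_nonneg v⟩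
  set μ := sInf S with hμ
  have hμ0 : 0 ≤ μ := le_csInf hSne (by rintro _ ⟨v, -, rfl⟩; exact A.quad_nonneg v)
  have hlow : ∀ v : H10 Ω, μ * ‖(v : L2 Ω)‖ ^ 2 ≤ A.quad v := by
    intro v
    by_cases hv : v = 0
    · simpa [hv] using A.quad_nonneg 0
    · have h1 : μ ≤ _ := csInf_le hSb ⟨_, hnorm v hv, rfl⟩
      have h0 : 0 < ‖(v : L2 Ω)‖ := norm_pos_iff.2 (by simpa using hv)
      rw [A.quad_smul, Complex.norm_real, norm_inv, norm_norm, inv_pow, inv_mul_eq_div,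
        le_div_iff₀ (by positivity)] at h1
      exact h1
  obtain ⟨r, -, hr, hrS⟩ := exists_seq_tendsto_sInf hSne hSb
  choose v hv1 hvr using hrS
  choose G hG using fun j => exists_isGrad (v j)
  -- the minimizing sequence is bounded, hence has a subsequence that converges in `L²`
  obtain ⟨R, hR⟩ : ∃ R : ℝ, ∀ j, ‖G j‖ ≤ R := by
    obtain ⟨M, hM⟩ := hr.bddAbove_range
    refine ⟨√(M / c₀), fun j => Real.le_sqrt_of_sq_le ?_⟩
    rw [le_div_iff₀ hc₀, mul_comm]
    exact (hcoer _ _ (hG j)).trans ((hvr j).le.trans (hM (mem_range_self j)))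
  obtain ⟨K, hK, hKim⟩ := (isCompactOperator_fst_H10Graph hΩo hΩb).image_closedBall_subset_compact
    (max 1 R)
  have hmem : ∀ j, (v j : L2 Ω) ∈ K := fun j => by
    refine hKim ⟨⟨((v j : L2 Ω), G j), hG j⟩, ?_, rfl⟩
    rw [mem_closedBall_zero_iff]
    exact max_le_max (hv1 j).le (hR j)
  obtain ⟨u, -, σ, hσ, hu⟩ := hK.tendsto_subseq hmem
  set w : ℕ → H10 Ω := fun j => v (σ j)
  set H : ℕ → L2Vec Ω := fun j => G (σ j)
  have hw1 : ∀ j, ‖(w j : L2 Ω)‖ = 1 := fun j => hv1 _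
  have hwr : Tendsto (fun j => A.quad (w j)) atTop (𝓝 μ) := by
    have := hr.comp hσ.tendsto_atTop
    exact this.congr fun j => (hvr _).symm
  have hgrad_sub : ∀ i j, IsGrad (w i - w j) (H i - H j) := fun i j =>
    (H10Graph Ω).sub_mem (hG (σ i)) (hG (σ j))
  -- the parallelogram law, with the lower bound `μ` for the Rayleigh quotient of the sum
  have hpar : ∀ i j, c₀ * ‖H i - H j‖ ^ 2 ≤
      2 * (A.quad (w i) - μ) + 2 * (A.quad (w j) - μ) +
        μ * ‖(w i : L2 Ω) - w j‖ ^ 2 := by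
    intro i j
    have h1 := hcoer _ _ (hgrad_sub i j)
    have h2 := hlow (w i + w j)
    have h3 := A.quad_add (w i) (w j)
    have h4 : A.quad (w i - w j) = A.quad (w i) - 2 * (A.form (w i) (w j)).re + A.quad (w j) := by
      have h5 := A.quad_add (w i) (-w j)
      have h6 : A.quad (-w j) = A.quad (w j) := by
        simp [EllipticForm.quad]
      rw [← sub_eq_add_neg, h6, map_neg, Complex.neg_re] at h5
      linarith
    have h5 := parallelogram_law_with_norm ℂ (w i : L2 Ω) (w j)
    rw [hw1, hw1] at h5
    rw [Submodule.coe_add] at h2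
    have h6 : (A.form (w i - w j) (w i - w j)).re = A.quad (w i - w j) := rfl
    nlinarith
  have hcau : CauchySeq H := by
    have hlim : Tendsto (fun p : ℕ × ℕ => (2 * (A.quad (w p.1) - μ) + 2 * (A.quad (w p.2) - μ) +
        μ * ‖(w p.1 : L2 Ω) - w p.2‖ ^ 2) / c₀) atTop (𝓝 0) := by
      rw [← prod_atTop_atTop_eq]
      have h1 := (hwr.sub_const μ).const_mul 2
      have h2 := ((hu.comp tendsto_fst).sub (hu.comp tendsto_snd)).norm.pow 2 |>.const_mul μ
      have := (((h1.comp tendsto_fst).add (h1.comp tendsto_snd)).add h2).div_const c₀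
      simpa using this
    refine cauchySeq_iff_tendsto_dist_atTop_0.2 ?_
    have hsq : Tendsto (fun p : ℕ × ℕ => dist (H p.1) (H p.2) ^ 2) atTop (𝓝 0) := by
      refine squeeze_zero (fun p => by positivity) (fun p => ?_) hlim
      rw [le_div_iff₀ hc₀, mul_comm, dist_eq_norm]
      exact hpar p.1 p.2
    have := hsq.sqrt
    simpa [Real.sqrt_sq dist_nonneg] using this
  obtain ⟨Gu, hGu⟩ := cauchySeq_tendsto_of_complete hcau
  have hgraph : (u, Gu) ∈ H10Graph Ω :=
    (Submodule.isClosed_topologicalClosure _).mem_of_tendsto (hu.prodMk_nhds hGu)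
      (.of_forall fun j => hG (σ j))
  set U : H10 Ω := ⟨u, (u, Gu), hgraph, rfl⟩ with hU
  have hUg : IsGrad U Gu := hgraph
  have hu1 : ‖(U : L2 Ω)‖ = 1 := by
    refine tendsto_nhds_unique hu.norm ?_
    exact tendsto_const_nhds.congr fun j => (hw1 j).symm
  have hquad : Tendsto (fun j => A.quad (w j)) atTop (𝓝 (A.quad U)) := by
    have hbd : ∀ j, |A.quad (w j) - A.quad U| ≤
        c₁ * ‖H j - Gu‖ * ‖H j‖ + c₁ * ‖Gu‖ * ‖H j - Gu‖ := by
      intro j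
      have hg : IsGrad (w j - U) (H j - Gu) := (H10Graph Ω).sub_mem (hG (σ j)) hgraph
      have h1 := hbdd _ _ _ _ hg (hG (σ j))
      have h2 := hbdd _ _ _ _ hUg hg
      have h3 : A.form (w j) (w j) - A.form U U =
          A.form (w j - U) (w j) + A.form U (w j - U) := by
        simp only [map_sub, LinearMap.sub_apply]; ring
      calc |A.quad (w j) - A.quad U| = |(A.form (w j) (w j) - A.form U U).re| := rfl
        _ ≤ ‖A.form (w j) (w j) - A.form U U‖ := Complex.abs_re_le_norm _
        _ ≤ _ := by rw [h3]; exact (norm_add_le _ _).trans (add_le_add h1 h2)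
    rw [tendsto_iff_norm_sub_tendsto_zero]
    refine squeeze_zero (fun j => norm_nonneg _) hbd ?_
    have h0 : Tendsto (fun j => ‖H j - Gu‖) atTop (𝓝 0) :=
      tendsto_iff_norm_sub_tendsto_zero.1 hGu
    have := ((h0.const_mul c₁).mul hGu.norm).add (h0.const_mul (c₁ * ‖Gu‖))
    simpa using this
  refine ⟨μ, U, ?_, hlow, ?_⟩
  · intro h
    rw [h] at hu1
    simp at hu1
  · rw [tendsto_nhds_unique hquad hwr, hu1]
    simp

/-- The Rayleigh quotient is bounded below by `λ₁`. -/
theorem EllipticForm.lam1_mul_le (A : EllipticForm Ω) (hΩo : IsOpen Ω)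
    (hΩb : Bornology.IsBounded Ω) (v : H10 Ω) : A.lam1 * ‖(v : L2 Ω)‖ ^ 2 ≤ A.quad v := by
  by_cases hv : v = 0
  · simpa [hv] using A.quad_nonneg 0
  obtain ⟨μ, u, hu, hlow, hup⟩ := A.exists_isMin hΩo hΩb hv
  have h1 : μ ∈ A.eigenvalues := ⟨u, hu, A.leq_of_isMin hlow hup⟩
  have h2 : A.lam1 ≤ μ := csInf_le ⟨0, fun _ h => A.eigenvalues_nonneg h⟩ h1
  refine le_trans ?_ (hlow v)
  gcongr

end Rayleigh

/-! ### Holomorphic functions in a strip and the trapezoidal rule -/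

theorem continuous_strip_line {f : ℂ → ℂ} {a b c : ℝ}
    (hf : ContinuousOn f (Complex.im ⁻¹' uIcc a b)) (hc : c ∈ uIcc a b) :
    Continuous fun x : ℝ => f (x + c * Complex.I) := by
  refine hf.comp_continuous (by fun_prop) fun x => ?_
  simpa using hc

theorem integrable_strip_line {f : ℂ → ℂ} {a b c : ℝ} {B : ℝ → ℝ}
    (hf : ContinuousOn f (Complex.im ⁻¹' uIcc a b)) (hB : Integrable B)
    (hfB : ∀ x y : ℝ, y ∈ uIcc a b → ‖f (x + y * Complex.I)‖ ≤ B x) (hc : c ∈ uIcc a b) :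
    Integrable fun x : ℝ => f (x + c * Complex.I) :=
  hB.mono' (continuous_strip_line hf hc).aestronglyMeasurable (.of_forall fun x => hfB x c hc)

/-- **Cauchy's theorem for a strip.** The integral of a holomorphic function over a horizontal
line does not depend on the height of the line, if the function is dominated by an integrable
function of the real part that vanishes at infinity. -/
theorem integral_line_eq_integral_line {f : ℂ → ℂ} {a b : ℝ} {B : ℝ → ℝ}
    (hf : DifferentiableOn ℂ f (Complex.im ⁻¹' uIcc a b)) (hB : Integrable B)
    (hB0 : Tendsto B (cocompact ℝ) (𝓝 0))
    (hfB : ∀ x y : ℝ, y ∈ uIcc a b → ‖f (x + y * Complex.I)‖ ≤ B x) :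
    ∫ x : ℝ, f (x + a * Complex.I) = ∫ x : ℝ, f (x + b * Complex.I) := by
  have hline : ∀ c ∈ uIcc a b, Tendsto (fun R : ℝ => ∫ x in (-R)..R, f (x + c * Complex.I)) atTop
      (𝓝 (∫ x : ℝ, f (x + c * Complex.I))) := fun c hc =>
    intervalIntegral_tendsto_integral (integrable_strip_line hf.continuousOn hB hfB hc)
      tendsto_neg_atTop_atBot tendsto_id
  have hvert : ∀ s : ℝ → ℝ, Tendsto s atTop (cocompact ℝ) →
      Tendsto (fun R : ℝ => ∫ y in a..b, f (s R + y * Complex.I)) atTop (𝓝 0) := by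
    intro s hs
    refine squeeze_zero_norm (a := fun R => B (s R) * |b - a|) (fun R => ?_) ?_
    · refine intervalIntegral.norm_integral_le_of_norm_le_const fun y hy => ?_
      exact hfB _ _ (uIoc_subset_uIcc hy)
    · simpa using (hB0.comp hs).mul_const |b - a|
  have hrect : ∀ R : ℝ, (∫ x in (-R)..R, f (x + a * Complex.I)) -
      (∫ x in (-R)..R, f (x + b * Complex.I)) +
      Complex.I • (∫ y in a..b, f (R + y * Complex.I)) -
      Complex.I • (∫ y in a..b, f ((-R : ℝ) + y * Complex.I)) = 0 := by
    intro R
    have := Complex.integral_boundary_rect_eq_zero_of_differentiableOn f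
      (⟨-R, a⟩ : ℂ) (⟨R, b⟩ : ℂ) (hf.mono fun z hz => hz.2)
    simpa using this
  have hpos := hvert id (by
    rw [cocompact_eq_atBot_atTop]; exact tendsto_id.mono_right le_sup_right)
  have hneg := hvert Neg.neg (by
    rw [cocompact_eq_atBot_atTop]; exact tendsto_neg_atTop_atBot.mono_right le_sup_left)
  have hlim := ((((hline a left_mem_uIcc).sub (hline b right_mem_uIcc)).add
    (hpos.const_smul Complex.I)).sub (hneg.const_smul Complex.I))
  have h0 := tendsto_nhds_unique (hlim.congr fun R => hrect R) tendsto_const_nhds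
  simpa [sub_eq_zero] using h0

/-- The modulus of `z ↦ exp (-2πi m z / k)` at `z = x + iη`. -/
theorem norm_fourierKernel (k η m x : ℝ) :
    ‖Complex.exp (-(2 * Real.pi * m / k : ℝ) * Complex.I * (x + η * Complex.I))‖ =
      Real.exp (2 * Real.pi * m / k * η) := by
  rw [Complex.norm_exp]
  congr 1
  simp

/-- Shifting the line of integration shows that the Fourier coefficients of a function holomorphic
in a strip of half-width `d` decay like `exp (-2πd|m|/k)`. -/
theorem norm_fourierCoeff_le {f : ℂ → ℂ} {d k : ℝ} {B : ℝ → ℝ} (hd : 0 < d)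
    (hf : DifferentiableOn ℂ f (Complex.im ⁻¹' uIcc (-d) d)) (hB : Integrable B)
    (hB0 : Tendsto B (cocompact ℝ) (𝓝 0))
    (hfB : ∀ x y : ℝ, y ∈ uIcc (-d) d → ‖f (x + y * Complex.I)‖ ≤ B x) (m : ℝ) {c : ℝ}
    (hc : c ∈ uIcc (-d) d) :
    ‖∫ x : ℝ, Complex.exp (-(2 * Real.pi * m / k : ℝ) * Complex.I * x) * f x‖ ≤
      Real.exp (2 * Real.pi * m / k * c) * ∫ x : ℝ, ‖f (x + c * Complex.I)‖ := by
  set M : ℝ := Real.exp (|2 * Real.pi * m / k| * d)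
  have h0 : (0 : ℝ) ∈ uIcc (-d) d := by rw [uIcc_of_le (by linarith)]; constructor <;> linarith
  have hsub : uIcc 0 c ⊆ uIcc (-d) d := uIcc_subset_uIcc h0 hc
  have key := integral_line_eq_integral_line (a := 0) (b := c)
    (f := fun z => Complex.exp (-(2 * Real.pi * m / k : ℝ) * Complex.I * z) * f z)
    (B := fun x => M * B x) ?_ (hB.const_mul M) (by simpa using hB0.const_mul M) ?_
  · simp only [Complex.ofReal_zero, zero_mul, add_zero] at key
    rw [key, ← integral_const_mul]
    refine (norm_integral_le_integral_norm _).trans (le_of_eq ?_)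
    refine integral_congr_ae (.of_forall fun x => ?_)
    simp only [norm_mul, norm_fourierKernel]
  · exact DifferentiableOn.mul (by fun_prop) (hf.mono (preimage_mono hsub))
  · intro x y hy
    rw [norm_mul, norm_fourierKernel]
    have hB' := hfB x y (hsub hy)
    refine mul_le_mul (Real.exp_le_exp.2 ?_) hB' (norm_nonneg _) (Real.exp_pos _).le
    have hy' : |y| ≤ d := by
      have := hsub hy
      rw [uIcc_of_le (by linarith)] at this
      exact abs_le.2 this
    calc 2 * Real.pi * m / k * y ≤ |2 * Real.pi * m / k * y| := le_abs_self _
      _ = |2 * Real.pi * m / k| * |y| := abs_mul _ _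
      _ ≤ _ := by gcongr

/-- **Exponential convergence of the trapezoidal rule.** By Poisson summation the error of the
trapezoidal rule with step `k` is the sum of the Fourier coefficients of order `m ≠ 0`, and each of
them is estimated on the line `Im z = -d` or `Im z = d` according to the sign of `m`. -/
theorem norm_integral_sub_tsum_le {f : ℂ → ℂ} {d k : ℝ} {B : ℝ → ℝ} (hd : 0 < d) (hk : 0 < k)
    (hf : DifferentiableOn ℂ f (Complex.im ⁻¹' uIcc (-d) d)) (hB : Integrable B)
    (hB0 : B =O[cocompact ℝ] fun x => |x| ^ (-2 : ℝ))
    (hfB : ∀ x y : ℝ, y ∈ uIcc (-d) d → ‖f (x + y * Complex.I)‖ ≤ B x) :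
    Summable (fun j : ℤ => f ((j : ℂ) * k)) ∧
    ‖(∫ x : ℝ, f x) - k * ∑' j : ℤ, f ((j : ℂ) * k)‖ ≤
      (∫ y : ℝ, ‖f (y + d * Complex.I)‖ + ‖f (y - d * Complex.I)‖) /
        (Real.exp (2 * Real.pi * d / k) - 1) := by
  have hBt : Tendsto B (cocompact ℝ) (𝓝 0) := by
    refine hB0.trans_tendsto ?_
    have := (tendsto_rpow_neg_atTop (y := 2) (by norm_num)).comp
      (tendsto_norm_cocompact_atTop (E := ℝ))
    exact this
  have h0 : (0 : ℝ) ∈ uIcc (-d) d := by rw [uIcc_of_le (by linarith)]; constructor <;> linarith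
  have hfc : Continuous fun x : ℝ => f x := by
    simpa using continuous_strip_line hf.continuousOn h0
  set F : ℝ → ℂ := fun x => f ((k * x : ℝ) : ℂ) with hF
  have hFc : Continuous F := hfc.comp (continuous_const.mul continuous_id)
  have hFO : F =O[cocompact ℝ] fun x => |x| ^ (-2 : ℝ) := by
    have h1 : F =O[cocompact ℝ] fun x => B (k * x) := by
      refine .of_bound 1 (.of_forall fun x => ?_)
      have := hfB (k * x) 0 h0
      simp only [Complex.ofReal_zero, zero_mul, add_zero] at this
      rw [one_mul]
      exact this.trans (Real.le_norm_self _)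
    have h2 : (fun x => B (k * x)) =O[cocompact ℝ] fun x => |k * x| ^ (-2 : ℝ) :=
      hB0.comp_tendsto (Homeomorph.mulLeft₀ k hk.ne').isClosedEmbedding.tendsto_cocompact
    refine h1.trans (h2.trans ?_)
    refine .of_bound (|k| ^ (-2 : ℝ)) (.of_forall fun x => ?_)
    rw [abs_mul, Real.mul_rpow (abs_nonneg _) (abs_nonneg _), norm_mul,
      Real.norm_of_nonneg (by positivity : 0 ≤ |k| ^ (-2 : ℝ))]
  -- the Fourier coefficients
  set a : ℝ → ℂ := fun m => ∫ x : ℝ, Complex.exp (-(2 * Real.pi * m / k : ℝ) * Complex.I * x) * f x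
    with ha
  have hFour : ∀ m : ℝ, (k : ℂ) * FourierTransform.fourier F m = a m := by
    intro m
    have := Measure.integral_comp_mul_left (a := k)
      (g := fun x : ℝ => Complex.exp (-(2 * Real.pi * m / k : ℝ) * Complex.I * x) * f x)
    rw [abs_of_pos (inv_pos.2 hk)] at this
    have h2 : FourierTransform.fourier F m = ∫ x : ℝ,
        Complex.exp (-(2 * Real.pi * m / k : ℝ) * Complex.I * (k * x : ℝ)) *
          f ((k * x : ℝ) : ℂ) := by
      rw [Real.fourier_eq']
      refine integral_congr_ae (.of_forall fun x => ?_)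
      simp only [smul_eq_mul, hF]
      congr 2
      have : (k : ℂ) ≠ 0 := by exact_mod_cast hk.ne'
      simp
      field_simp
    rw [h2, this, Complex.real_smul]
    have : (k : ℂ) ≠ 0 := by exact_mod_cast hk.ne'
    push_cast
    rw [← mul_assoc, mul_inv_cancel₀ this, one_mul, ha]
    push_cast
    rfl
  set r : ℝ := Real.exp (-(2 * Real.pi * d / k)) with hr
  have hr0 : 0 < r := Real.exp_pos _
  have hr1 : r < 1 := Real.exp_lt_one_iff.2 (by have := Real.pi_pos; simp; positivity)
  set Ip := ∫ y : ℝ, ‖f (y + d * Complex.I)‖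
  set Im := ∫ y : ℝ, ‖f (y - d * Complex.I)‖
  have hrpow : ∀ n : ℕ, r ^ n = Real.exp (2 * Real.pi * n / k * -d) := by
    intro n
    rw [hr, ← Real.exp_nat_mul]; congr 1; ring
  have hpos : ∀ n : ℕ, ‖a n‖ ≤ r ^ n * Im := by
    intro n
    have := norm_fourierCoeff_le (k := k) hd hf hB hBt hfB n (c := -d) left_mem_uIcc
    rw [hrpow]
    simpa only [ha, Complex.ofReal_neg, neg_mul, ← sub_eq_add_neg] using this
  have hneg : ∀ n : ℕ, ‖a (-n)‖ ≤ r ^ n * Ip := by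
    intro n
    have := norm_fourierCoeff_le (k := k) hd hf hB hBt hfB (-n) (c := d) right_mem_uIcc
    rw [hrpow]
    refine this.trans (le_of_eq ?_)
    congr 2; ring
  have hgeo := summable_geometric_of_lt_one hr0.le hr1
  have hgeo1 : HasSum (fun n : ℕ => r ^ (n + 1)) (r / (1 - r)) := by
    simpa [pow_succ', div_eq_mul_inv] using (hasSum_geometric_of_lt_one hr0.le hr1).mul_left r
  have hsp : Summable fun n : ℕ => a ((n : ℝ) + 1) :=
    .of_norm_bounded (hgeo1.summable.mul_right Im) fun n => by exact_mod_cast hpos (n + 1)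
  have hsn : Summable fun n : ℕ => a (-((n : ℝ) + 1)) :=
    .of_norm_bounded (hgeo1.summable.mul_right Ip) fun n => by exact_mod_cast hneg (n + 1)
  have hsa : Summable fun m : ℤ => a m :=
    Summable.of_add_one_of_neg_add_one (by exact_mod_cast hsp) (by
      refine hsn.congr fun n => ?_
      push_cast; rfl)
  have hta : ∑' m : ℤ, a m = (∑' n : ℕ, a ((n : ℝ) + 1)) + a 0 + ∑' n : ℕ, a (-((n : ℝ) + 1)) := by
    rw [tsum_of_add_one_of_neg_add_one (f := fun m : ℤ => a m) (by exact_mod_cast hsp) (by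
      refine hsn.congr fun n => ?_
      push_cast; rfl)]
    push_cast
    rfl
  have hk' : (k : ℂ) ≠ 0 := by exact_mod_cast hk.ne'
  have hsF : Summable fun m : ℤ => FourierTransform.fourier F (m : ℝ) := by
    refine (hsa.mul_left (k : ℂ)⁻¹).congr fun m => ?_
    rw [← hFour, inv_mul_cancel_left₀ hk']
  have hpoisson := Real.tsum_eq_tsum_fourier_of_rpow_decay_of_summable hFc one_lt_two hFO hsF 0
  have hFj : ∀ j : ℤ, F j = f ((j : ℂ) * k) := fun j => by
    simp [hF, mul_comm]
  have hsum : (k : ℂ) * ∑' j : ℤ, f ((j : ℂ) * k) = ∑' m : ℤ, a m := by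
    simp only [zero_add, hFj, AddCircle.coe_zero, fourier_eval_zero, mul_one] at hpoisson
    rw [hpoisson, ← tsum_mul_left]
    simp only [hFour]
  refine ⟨?_, ?_⟩
  · have := summable_of_isBigO (Real.summable_abs_int_rpow one_lt_two)
      (hFO.comp_tendsto Int.tendsto_coe_cofinite)
    exact this.congr fun j => hFj j
  have ha0 : a 0 = ∫ x : ℝ, f x := by simp [ha]
  have hint : (∫ y : ℝ, ‖f (y + d * Complex.I)‖ + ‖f (y - d * Complex.I)‖) = Ip + Im := by
    refine integral_add
      (integrable_strip_line hf.continuousOn hB hfB right_mem_uIcc).norm ?_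
    have := (integrable_strip_line hf.continuousOn hB hfB left_mem_uIcc).norm
    simpa only [Complex.ofReal_neg, neg_mul, ← sub_eq_add_neg] using this
  rw [hsum, hta, ha0, hint]
  have hb1 : ‖∑' n : ℕ, a ((n : ℝ) + 1)‖ ≤ r / (1 - r) * Im :=
    tsum_of_norm_bounded (hgeo1.mul_right Im) fun n => by exact_mod_cast hpos (n + 1)
  have hb2 : ‖∑' n : ℕ, a (-((n : ℝ) + 1))‖ ≤ r / (1 - r) * Ip :=
    tsum_of_norm_bounded (hgeo1.mul_right Ip) fun n => by exact_mod_cast hneg (n + 1)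
  have hrr : r / (1 - r) = 1 / (Real.exp (2 * Real.pi * d / k) - 1) := by
    have hE : Real.exp (2 * Real.pi * d / k) = r⁻¹ := by rw [hr, Real.exp_neg, inv_inv]
    rw [hE]
    have : 1 - r ≠ 0 := by linarith
    have h3 : r⁻¹ - 1 = (1 - r) / r := by field_simp
    rw [h3, one_div_div]
  rw [hrr] at hb1 hb2
  calc _ = ‖(∑' n : ℕ, a ((n : ℝ) + 1)) + ∑' n : ℕ, a (-((n : ℝ) + 1))‖ := by
        rw [← norm_neg]; congr 1; ring
    _ ≤ _ := norm_add_le _ _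
    _ ≤ _ := add_le_add hb1 hb2
    _ = _ := by ring

/-! ### Geometry of the hyperbolic contour -/

/-- The contour is the image of the line `Im ζ = π / 4` under `ζ ↦ √2 b cosh ζ`. -/
theorem hypContour_eq_cosh (b : ℝ) (z : ℂ) :
    hypContour b z = (√2 * b : ℝ) * Complex.cosh (z + (Real.pi / 4 : ℝ) * Complex.I) := by
  have h2 : ((√2 : ℝ) : ℂ) * ((√2 : ℝ) : ℂ) = 2 := by
    rw [← Complex.ofReal_mul, Real.mul_self_sqrt (by norm_num)]; norm_num
  rw [hypContour, Complex.cosh_add, Complex.cosh_mul_I, Complex.sinh_mul_I, ← Complex.ofReal_cos,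
    ← Complex.ofReal_sin, Real.cos_pi_div_four, Real.sin_pi_div_four]
  push_cast
  linear_combination (-(b : ℂ) / 2) * (Complex.cosh z + Complex.I * Complex.sinh z) * h2

theorem hasDerivAt_hypContour (b : ℝ) (z : ℂ) :
    HasDerivAt (hypContour b)
      ((√2 * b : ℝ) * Complex.sinh (z + (Real.pi / 4 : ℝ) * Complex.I)) z := by
  have h : hypContour b = fun z => ((√2 * b : ℝ) : ℂ) *
      Complex.cosh (z + (Real.pi / 4 : ℝ) * Complex.I) := funext (hypContour_eq_cosh b)
  rw [h]
  have := ((hasDerivAt_id z).add_const ((Real.pi / 4 : ℝ) * Complex.I)).ccosh.const_mul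
    ((√2 * b : ℝ) : ℂ)
  simpa using this

theorem deriv_hypContour (b : ℝ) (z : ℂ) :
    deriv (hypContour b) z =
      (√2 * b : ℝ) * Complex.sinh (z + (Real.pi / 4 : ℝ) * Complex.I) :=
  (hasDerivAt_hypContour b z).deriv

theorem cosh_add_mul_I_re (x θ : ℝ) :
    (Complex.cosh (x + θ * Complex.I)).re = Real.cosh x * Real.cos θ := by
  rw [Complex.cosh_add, Complex.cosh_mul_I, Complex.sinh_mul_I, ← Complex.ofReal_cos,
    ← Complex.ofReal_sin, ← Complex.ofReal_cosh, ← Complex.ofReal_sinh]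
  simp only [Complex.add_re, Complex.mul_re, Complex.mul_im, Complex.ofReal_re,
    Complex.ofReal_im, Complex.I_re, Complex.I_im]
  ring

theorem cosh_add_mul_I_im (x θ : ℝ) :
    (Complex.cosh (x + θ * Complex.I)).im = Real.sinh x * Real.sin θ := by
  rw [Complex.cosh_add, Complex.cosh_mul_I, Complex.sinh_mul_I, ← Complex.ofReal_cos,
    ← Complex.ofReal_sin, ← Complex.ofReal_cosh, ← Complex.ofReal_sinh]
  simp only [Complex.add_im, Complex.mul_re, Complex.mul_im, Complex.ofReal_re,
    Complex.ofReal_im, Complex.I_re, Complex.I_im]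
  ring

theorem norm_cosh_le (x θ : ℝ) : ‖Complex.cosh (x + θ * Complex.I)‖ ≤ Real.cosh x := by
  refine abs_le_of_sq_le_sq' ?_ (Real.cosh_pos x).le |>.2
  rw [Complex.sq_norm, Complex.normSq_apply, cosh_add_mul_I_re, cosh_add_mul_I_im]
  nlinarith [Real.cosh_sq x, Real.sin_sq_add_cos_sq θ, sq_nonneg (Real.sin θ), sq_nonneg
    (Real.cos θ), Real.cosh_sq_sub_sinh_sq x]

theorem norm_sinh_le (x θ : ℝ) : ‖Complex.sinh (x + θ * Complex.I)‖ ≤ Real.cosh x := by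
  refine abs_le_of_sq_le_sq' ?_ (Real.cosh_pos x).le |>.2
  rw [Complex.sinh_add, Complex.cosh_mul_I, Complex.sinh_mul_I, ← Complex.ofReal_cos,
    ← Complex.ofReal_sin, ← Complex.ofReal_cosh, ← Complex.ofReal_sinh, Complex.sq_norm,
    Complex.normSq_apply]
  simp only [Complex.add_re, Complex.mul_re, Complex.ofReal_re, Complex.ofReal_im, Complex.I_re,
    Complex.I_im, Complex.add_im, Complex.mul_im]
  nlinarith [Real.cosh_sq x, Real.sin_sq_add_cos_sq θ, sq_nonneg (Real.sin θ), sq_nonneg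
    (Real.cos θ), Real.cosh_sq_sub_sinh_sq x]

/-- The curve `x ↦ c cosh (x + iθ)` stays in a sector, on which the real part of the `β`-th power
is bounded below. -/
theorem le_re_cosh_cpow {c β θ θ₁ : ℝ} (hc : 0 < c) (hβ0 : 0 < β) (hβ1 : β < 1)
    (hθ : |θ| ≤ θ₁) (hθ₁ : θ₁ < Real.pi / 2) (x : ℝ) :
    Real.cos (β * θ₁) * (c * Real.cos θ₁) ^ β * Real.cosh x ^ β ≤
      (((c : ℂ) * Complex.cosh (x + θ * Complex.I)) ^ (β : ℂ)).re := by
  set w : ℂ := (c : ℂ) * Complex.cosh (x + θ * Complex.I) with hw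
  have hθ0 : 0 ≤ θ₁ := (abs_nonneg θ).trans hθ
  have hcos1 : 0 < Real.cos θ₁ := Real.cos_pos_of_mem_Ioo ⟨by linarith, hθ₁⟩
  have hcos : Real.cos θ₁ ≤ Real.cos θ := by
    rw [← Real.cos_abs θ]
    exact Real.cos_le_cos_of_nonneg_of_le_pi (abs_nonneg θ) (by linarith) hθ
  have hch : 0 < Real.cosh x := Real.cosh_pos x
  have hre : w.re = c * (Real.cosh x * Real.cos θ) := by
    rw [hw, Complex.re_ofReal_mul, cosh_add_mul_I_re]
  have hnorm : ‖w‖ ≤ c * Real.cosh x := by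
    rw [hw, norm_mul, Complex.norm_real, Real.norm_of_nonneg hc.le]
    exact mul_le_mul_of_nonneg_left (norm_cosh_le x θ) hc.le
  have hlow : c * Real.cos θ₁ * Real.cosh x ≤ ‖w‖ := by
    refine le_trans ?_ (Complex.re_le_norm w)
    rw [hre]
    nlinarith [mul_le_mul_of_nonneg_left hcos (mul_pos hc hch).le]
  have hw0 : w ≠ 0 := by
    intro h
    rw [h, norm_zero] at hlow
    have : 0 < c * Real.cos θ₁ * Real.cosh x := by positivity
    linarith
  have harg : |w.arg| ≤ θ₁ := by
    by_contra! hlt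
    have h1 : Real.cos |w.arg| < Real.cos θ₁ :=
      Real.cos_lt_cos_of_nonneg_of_le_pi hθ0 (Complex.abs_arg_le_pi w) hlt
    rw [Real.cos_abs, Complex.cos_arg hw0, div_lt_iff₀ (norm_pos_iff.2 hw0), hre] at h1
    have h2 : Real.cos θ₁ * ‖w‖ ≤ Real.cos θ * (c * Real.cosh x) :=
      mul_le_mul hcos hnorm (norm_nonneg _) (hcos1.le.trans hcos)
    nlinarith
  rw [Complex.cpow_ofReal_re]
  have h1 : Real.cos (β * θ₁) ≤ Real.cos (w.arg * β) := by
    rw [← Real.cos_abs (w.arg * β), abs_mul, abs_of_pos hβ0, mul_comm |w.arg|]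
    refine Real.cos_le_cos_of_nonneg_of_le_pi (by positivity) (by nlinarith) ?_
    gcongr
  have h0 : 0 ≤ Real.cos (β * θ₁) :=
    Real.cos_nonneg_of_mem_Icc ⟨by nlinarith, by nlinarith⟩
  rw [mul_assoc, ← Real.mul_rpow (by positivity) hch.le, mul_comm]
  gcongr

/-- For `θ` in a compact part of `(0, π / 2)` and `λ ≥ λ₁ > c`, the distance between `λ` and the
point `c cosh (x + iθ)` is at least comparable with `cosh x`: for small `x` the real part of the
curve stays to the left of `λ₁`, and for the other `x` the imaginary part is large. -/
theorem exists_le_norm_cosh_sub {c l s : ℝ} (hc : 0 < c) (hl : c < l) (hs : 0 < s) :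
    ∃ δ : ℝ, 0 < δ ∧ ∀ lam θ x : ℝ, l ≤ lam → s ≤ Real.sin θ →
      δ * Real.cosh x ≤ ‖(c : ℂ) * Complex.cosh (x + θ * Complex.I) - lam‖ := by
  -- while `cosh x ≤ ρ`, the real part of the curve is at most `(c + l) / 2`
  set ρ : ℝ := (c + l) / 2 / c with hρ
  have hρ1 : 1 < ρ := by rw [hρ, lt_div_iff₀ hc]; linarith
  have hρ0 : 0 < ρ := by linarith
  have hcρ : c * ρ = (c + l) / 2 := by rw [hρ]; field_simp
  have hρ2 : 0 < 1 - (ρ ^ 2)⁻¹ := by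
    have : (ρ ^ 2)⁻¹ < 1 := inv_lt_one_of_one_lt₀ (by nlinarith)
    linarith
  set δ₁ := (l - c) / 2 / ρ
  set δ₂ := c * s * √(1 - (ρ ^ 2)⁻¹)
  have hδ₁ : 0 < δ₁ := div_pos (by linarith) hρ0
  have hδ₂ : 0 < δ₂ := by positivity
  refine ⟨min δ₁ δ₂, lt_min hδ₁ hδ₂, fun lam θ x hlam hθ => ?_⟩
  have hch := Real.cosh_pos x
  rcases le_or_gt (Real.cosh x) ρ with h | h
  · refine le_trans ?_ (Complex.abs_re_le_norm _)
    rw [Complex.sub_re, Complex.re_ofReal_mul, cosh_add_mul_I_re, Complex.ofReal_re, abs_sub_comm]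
    refine le_trans ?_ (le_abs_self _)
    have h1 : c * (Real.cosh x * Real.cos θ) ≤ (c + l) / 2 := by
      rw [← hcρ]
      refine mul_le_mul_of_nonneg_left ?_ hc.le
      nlinarith [Real.cos_le_one θ]
    have h2 : min δ₁ δ₂ * Real.cosh x ≤ δ₁ * ρ :=
      mul_le_mul (min_le_left _ _) h hch.le hδ₁.le
    have h3 : δ₁ * ρ = (l - c) / 2 := div_mul_cancel₀ _ hρ0.ne'
    linarith
  · refine le_trans ?_ (Complex.abs_im_le_norm _)
    rw [Complex.sub_im, Complex.im_ofReal_mul, cosh_add_mul_I_im, Complex.ofReal_im, sub_zero,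
      abs_mul, abs_mul, abs_of_pos hc, abs_of_pos (hs.trans_le hθ)]
    have h1 : √(1 - (ρ ^ 2)⁻¹) * Real.cosh x ≤ |Real.sinh x| := by
      refine abs_le_of_sq_le_sq' ?_ (abs_nonneg _) |>.2
      rw [mul_pow, Real.sq_sqrt hρ2.le, sq_abs, Real.sinh_sq]
      have : 1 ≤ (ρ ^ 2)⁻¹ * Real.cosh x ^ 2 := by
        rw [← div_eq_inv_mul, one_le_div (by positivity)]
        gcongr
      nlinarith
    calc min δ₁ δ₂ * Real.cosh x ≤ δ₂ * Real.cosh x := by gcongr; exact min_le_right _ _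
      _ = c * (√(1 - (ρ ^ 2)⁻¹) * Real.cosh x * s) := by ring
      _ ≤ _ := by gcongr

theorem half_exp_abs_le_cosh (x : ℝ) : Real.exp |x| / 2 ≤ Real.cosh x := by
  rw [← Real.cosh_abs, Real.cosh_eq]
  have := Real.exp_pos (-|x|)
  linarith

theorem exp_abs_rpow_le_cosh_rpow {β : ℝ} (hβ : 0 < β) (x : ℝ) :
    2 ^ (-β) * Real.exp (β * |x|) ≤ Real.cosh x ^ β := by
  calc 2 ^ (-β) * Real.exp (β * |x|) = (Real.exp |x| / 2) ^ β := by
        rw [Real.div_rpow (Real.exp_pos _).le (by norm_num), ← Real.exp_mul,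
          Real.rpow_neg (by norm_num), mul_comm β, div_eq_inv_mul]
    _ ≤ _ := Real.rpow_le_rpow (by positivity) (half_exp_abs_le_cosh x) hβ.le

theorem kap_pos {β b d : ℝ} (hβ0 : 0 < β) (hβ1 : β < 1) (hb : 0 < b) (hd0 : 0 < d)
    (hd1 : d < Real.pi / 4) : 0 < kap β b d := by
  have h1 : 0 < Real.cos (β * (Real.pi / 4 + d)) :=
    Real.cos_pos_of_mem_Ioo ⟨by nlinarith [Real.pi_pos], by nlinarith⟩
  have h2 : 0 < Real.sin (Real.pi / 4 - d) :=
    Real.sin_pos_of_pos_of_lt_pi (by linarith) (by linarith [Real.pi_pos])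
  rw [kap]
  positivity

theorem hypContour_line (b x η : ℝ) :
    hypContour b (x + η * Complex.I) =
      (√2 * b : ℝ) * Complex.cosh (x + (η + Real.pi / 4 : ℝ) * Complex.I) := by
  rw [hypContour_eq_cosh]; push_cast; ring_nf

theorem hypContour_line_re_pos {b η : ℝ} (hb : 0 < b) (hη : |η| < Real.pi / 4) (x : ℝ) :
    0 < (hypContour b (x + η * Complex.I)).re := by
  rw [hypContour_line, Complex.re_ofReal_mul, cosh_add_mul_I_re]
  have := abs_lt.1 hη
  have h2 : 0 < Real.cos (η + Real.pi / 4) :=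
    Real.cos_pos_of_mem_Ioo ⟨by linarith, by linarith⟩
  have := Real.cosh_pos x
  positivity

theorem kap_mul_le_re_cpow {β b d η : ℝ} (hβ0 : 0 < β) (hβ1 : β < 1) (hb : 0 < b)
    (hd1 : d < Real.pi / 4) (hη : |η| ≤ d) (x : ℝ) :
    kap β b d * 2 ^ (-β) * Real.exp (β * |x|) ≤
      (hypContour b (x + η * Complex.I) ^ (β : ℂ)).re := by
  have hη' := abs_le.1 hη
  have hd0 : 0 ≤ d := (abs_nonneg _).trans hη
  have hcos : Real.cos (Real.pi / 4 + d) = Real.sin (Real.pi / 4 - d) := by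
    rw [← Real.cos_pi_div_two_sub]; congr 1; ring
  have h := le_re_cosh_cpow (c := √2 * b) (β := β) (θ := η + Real.pi / 4) (θ₁ := Real.pi / 4 + d)
    (by positivity) hβ0 hβ1 (by rw [abs_le]; constructor <;> linarith) (by linarith) x
  rw [hcos] at h
  rw [hypContour_line]
  refine le_trans ?_ h
  have hk : Real.cos (β * (Real.pi / 4 + d)) * (√2 * b * Real.sin (Real.pi / 4 - d)) ^ β =
    kap β b d := rfl
  have hk0 : 0 ≤ kap β b d := by
    have h1 : 0 ≤ Real.cos (β * (Real.pi / 4 + d)) :=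
      Real.cos_nonneg_of_mem_Icc ⟨by nlinarith [Real.pi_pos], by nlinarith [Real.pi_pos]⟩
    have h2 : 0 ≤ Real.sin (Real.pi / 4 - d) :=
      Real.sin_nonneg_of_nonneg_of_le_pi (by linarith) (by linarith [Real.pi_pos])
    rw [kap]; positivity
  rw [hk, mul_assoc]
  exact mul_le_mul_of_nonneg_left (exp_abs_rpow_le_cosh_rpow hβ0 x) hk0

/-- The constant `K` bounds `|γ'(z) / (γ(z) - λ)|` in the strip `|Im z| ≤ d`, uniformly in
`λ ≥ λ₁`. -/
theorem exists_norm_deriv_hypContour_le {b d l : ℝ} (hb : 0 < b) (hd0 : 0 < d)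
    (hd1 : d < Real.pi / 4) (hl : √2 * b < l) :
    ∃ K : ℝ, 0 < K ∧ ∀ lam x η : ℝ, l ≤ lam → |η| ≤ d →
      hypContour b (x + η * Complex.I) - lam ≠ 0 ∧
      ‖deriv (hypContour b) (x + η * Complex.I)‖ ≤
        K * ‖hypContour b (x + η * Complex.I) - lam‖ := by
  have hs : 0 < Real.sin (Real.pi / 4 - d) :=
    Real.sin_pos_of_pos_of_lt_pi (by linarith) (by linarith [Real.pi_pos])
  have hc : 0 < √2 * b := by positivity
  obtain ⟨δ, hδ, h⟩ := exists_le_norm_cosh_sub hc hl hs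
  refine ⟨√2 * b / δ, by positivity, fun lam x η hlam hη => ?_⟩
  have hη' := abs_le.1 hη
  have h1 := h lam (η + Real.pi / 4) x hlam
    (Real.sin_le_sin_of_le_of_le_pi_div_two (by linarith) (by linarith) (by linarith))
  rw [← hypContour_line] at h1
  have hch := Real.cosh_pos x
  refine ⟨fun h0 => ?_, ?_⟩
  · rw [h0, norm_zero] at h1
    have : 0 < δ * Real.cosh x := by positivity
    linarith
  · have h2 : ‖deriv (hypContour b) (x + η * Complex.I)‖ ≤ √2 * b * Real.cosh x := by
      rw [deriv_hypContour, norm_mul, Complex.norm_real, Real.norm_of_nonneg hc.le]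
      refine mul_le_mul_of_nonneg_left ?_ hc.le
      have h3 : (x : ℂ) + η * Complex.I + (Real.pi / 4 : ℝ) * Complex.I =
          x + (η + Real.pi / 4 : ℝ) * Complex.I := by push_cast; ring
      rw [h3]
      exact norm_sinh_le x (η + Real.pi / 4)
    calc _ ≤ _ := h2
      _ = √2 * b / δ * (δ * Real.cosh x) := by field_simp
      _ ≤ _ := by gcongr

/-- Double exponential decay of `g_λ(·, t)` in the strip `|Im z| ≤ d`. -/
theorem norm_gFun_le {β b d l K : ℝ} (hβ0 : 0 < β) (hβ1 : β < 1) (hb : 0 < b)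
    (hd1 : d < Real.pi / 4)
    (hK : ∀ lam x η : ℝ, l ≤ lam → |η| ≤ d →
      hypContour b (x + η * Complex.I) - lam ≠ 0 ∧
      ‖deriv (hypContour b) (x + η * Complex.I)‖ ≤
        K * ‖hypContour b (x + η * Complex.I) - lam‖)
    {lam t η : ℝ} (ht : 0 < t) (hlam : l ≤ lam) (hη : |η| ≤ d) (x : ℝ) :
    ‖gFun β b lam t (x + η * Complex.I)‖ ≤
      K * Real.exp (-(kap β b d * 2 ^ (-β) * t * Real.exp (β * |x|))) := by
  obtain ⟨h0, hK⟩ := hK lam x η hlam hη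
  rw [gFun, norm_mul, norm_mul, norm_inv, Complex.norm_exp]
  have h1 : (-(t : ℂ) * hypContour b (x + η * Complex.I) ^ (β : ℂ)).re ≤
      -(kap β b d * 2 ^ (-β) * t * Real.exp (β * |x|)) := by
    rw [← Complex.ofReal_neg, Complex.re_ofReal_mul]
    have := kap_mul_le_re_cpow hβ0 hβ1 hb hd1 hη x
    nlinarith
  have h2 : ‖hypContour b (x + η * Complex.I) - lam‖⁻¹ *
      ‖deriv (hypContour b) (x + η * Complex.I)‖ ≤ K := by
    rw [inv_mul_le_iff₀ (norm_pos_iff.2 h0), mul_comm _ K]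
    exact hK
  rw [mul_assoc, mul_comm K]
  exact mul_le_mul (Real.exp_le_exp.2 h1) h2 (by positivity) (Real.exp_pos _).le

theorem differentiableOn_gFun {β b d l : ℝ} (hb : 0 < b)
    (hd1 : d < Real.pi / 4) {lam t : ℝ} (hlam : l ≤ lam)
    (hK : ∀ lam x η : ℝ, l ≤ lam → |η| ≤ d → hypContour b (x + η * Complex.I) - lam ≠ 0) :
    DifferentiableOn ℂ (gFun β b lam t) {z | |z.im| ≤ d} := by
  have hγ : Differentiable ℂ (hypContour b) := fun z =>
    (hasDerivAt_hypContour b z).differentiableAt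
  have hγ' : Differentiable ℂ (deriv (hypContour b)) := by
    rw [funext (deriv_hypContour b)]
    fun_prop
  intro z hz
  refine DifferentiableAt.differentiableWithinAt ?_
  have hne := hK lam z.re z.im hlam hz
  have hre := hypContour_line_re_pos hb (lt_of_le_of_lt hz hd1) z.re
  rw [Complex.re_add_im] at hne hre
  unfold gFun
  refine DifferentiableAt.mul (DifferentiableAt.mul ?_ ?_) (hγ' z)
  · exact (((hγ z).cpow_const (.inl hre)).const_mul _).cexp
  · exact ((hγ z).sub_const _).inv hne

/-! ### Double exponential integrals and the quantities `M(t)` and `N(d, t)` -/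

/-- The double exponential `exp (-a (e^{βy} - 1))`, normalized to be `1` at `y = 0`. -/
def doubleExp (a β y : ℝ) : ℝ := Real.exp (-(a * (Real.exp (β * y) - 1)))

theorem continuous_doubleExp (a β : ℝ) : Continuous (doubleExp a β) := by
  unfold doubleExp; fun_prop

theorem doubleExp_pos (a β y : ℝ) : 0 < doubleExp a β y := Real.exp_pos _

theorem doubleExp_le_one {a β y : ℝ} (ha : 0 ≤ a) (hβ : 0 ≤ β) (hy : 0 ≤ y) :
    doubleExp a β y ≤ 1 := by
  have : 1 ≤ Real.exp (β * y) := Real.one_le_exp (by positivity)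
  exact Real.exp_le_one_iff.2 (by nlinarith)

theorem antitone_doubleExp {a β : ℝ} (ha : 0 ≤ a) (hβ : 0 ≤ β) : Antitone (doubleExp a β) := by
  intro x y hxy
  unfold doubleExp
  gcongr

theorem exp_neg_mul_exp (a β y : ℝ) :
    Real.exp (-(a * Real.exp (β * y))) = Real.exp (-a) * doubleExp a β y := by
  rw [doubleExp, ← Real.exp_add]; congr 1; ring

/-- With `Y = max (-log a) 0 / β` one has `doubleExp a β y ≤ exp (-β (y - Y))`. -/
theorem doubleExp_le {a β : ℝ} (ha : 0 < a) (hβ : 0 < β) (y : ℝ)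
    (hy : max (-Real.log a) 0 / β ≤ y) :
    doubleExp a β y ≤ Real.exp (-β * (y - max (-Real.log a) 0 / β)) := by
  refine Real.exp_le_exp.2 ?_
  have hmul : β * (y - max (-Real.log a) 0 / β) = β * y - max (-Real.log a) 0 := by
    field_simp
  rw [div_le_iff₀ hβ] at hy
  rw [neg_mul, neg_le_neg_iff, hmul]
  rcases le_total a 1 with h | h
  · have hlog : Real.log a ≤ 0 := Real.log_nonpos ha.le h
    rw [max_eq_left (by linarith)]
    have h1 : a * Real.exp (β * y) = Real.exp (β * y + Real.log a) := by
      rw [Real.exp_add, Real.exp_log ha]; ring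
    have := Real.add_one_le_exp (β * y + Real.log a)
    nlinarith
  · have hlog : 0 ≤ Real.log a := Real.log_nonneg h
    rw [max_eq_right (by linarith)] at hy ⊢
    have := Real.add_one_le_exp (β * y)
    nlinarith

theorem integrableOn_doubleExp_and_integral_le {a β : ℝ} (ha : 0 < a) (hβ : 0 < β) :
    IntegrableOn (doubleExp a β) (Ioi 0) ∧
      ∫ y in Ioi 0, doubleExp a β y ≤ (1 + max (-Real.log a) 0) / β := by
  set Y := max (-Real.log a) 0 / β with hY
  have hY0 : 0 ≤ Y := by positivity
  have hexp : IntegrableOn (fun y => Real.exp (-β * (y - Y))) (Ioi Y) := by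
    have := (integrableOn_exp_mul_Ioi (a := -β) (by linarith) Y).const_mul (Real.exp (β * Y))
    refine IntegrableOn.congr_fun this (fun y _ => ?_) measurableSet_Ioi
    simp only [← Real.exp_add]; congr 1; ring
  have hval : ∫ y in Ioi Y, Real.exp (-β * (y - Y)) = 1 / β := by
    have h := integral_exp_mul_Ioi (a := -β) (by linarith) Y
    have h2 : ∀ y : ℝ, Real.exp (-β * (y - Y)) = Real.exp (β * Y) * Real.exp (-β * y) := fun y => by
      rw [← Real.exp_add]; congr 1; ring
    simp only [h2]
    rw [integral_const_mul, h, neg_div_neg_eq, mul_div_assoc', ← Real.exp_add]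
    simp
  have h1 : IntegrableOn (doubleExp a β) (Ioi Y) :=
    hexp.mono' (continuous_doubleExp a β).aestronglyMeasurable.restrict
      ((ae_restrict_iff' measurableSet_Ioi).2 (.of_forall fun y hy => by
        rw [Real.norm_of_nonneg (doubleExp_pos _ _ _).le]
        exact doubleExp_le ha hβ y (le_of_lt hy)))
  have h2 : IntegrableOn (doubleExp a β) (Ioc 0 Y) :=
    ((continuous_doubleExp a β).integrableOn_Icc).mono_set Ioc_subset_Icc_self
  have hU : Ioi (0 : ℝ) = Ioc 0 Y ∪ Ioi Y := (Ioc_union_Ioi_eq_Ioi hY0).symm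
  refine ⟨by rw [hU]; exact h2.union h1, ?_⟩
  rw [hU, setIntegral_union (Ioc_disjoint_Ioi le_rfl) measurableSet_Ioi h2 h1]
  have i1 : ∫ y in Ioc 0 Y, doubleExp a β y ≤ Y := by
    calc _ ≤ ∫ _ in Ioc 0 Y, (1 : ℝ) := setIntegral_mono_on h2 (by simp) measurableSet_Ioc
          fun y hy => doubleExp_le_one ha.le hβ.le hy.1.le
      _ = Y := by simp [hY0]
  have i2 : ∫ y in Ioi Y, doubleExp a β y ≤ 1 / β := by
    rw [← hval]
    exact setIntegral_mono_on h1 hexp measurableSet_Ioi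
      fun y hy => doubleExp_le ha hβ y (le_of_lt hy)
  have : (1 + max (-Real.log a) 0) / β = Y + 1 / β := by rw [hY]; ring
  linarith

theorem integrable_exp_neg_mul_exp_abs {a β : ℝ} (ha : 0 < a) (hβ : 0 < β) :
    Integrable fun y : ℝ => Real.exp (-(a * Real.exp (β * |y|))) := by
  simp only [exp_neg_mul_exp]
  refine Integrable.const_mul ?_ _
  have h1 : Integrable ((Ici 0).indicator (doubleExp a β)) :=
    (integrable_indicator_iff measurableSet_Ici).2
      ((integrableOn_Ici_iff_integrableOn_Ioi).2 (integrableOn_doubleExp_and_integral_le ha hβ).1)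
  refine (h1.add h1.comp_neg).mono'
    ((continuous_doubleExp a β).comp continuous_abs).aestronglyMeasurable (.of_forall fun y => ?_)
  have h0 : ∀ z, 0 ≤ (Ici 0).indicator (doubleExp a β) z :=
    indicator_nonneg fun z _ => (doubleExp_pos _ _ _).le
  rw [Real.norm_of_nonneg (doubleExp_pos _ _ _).le, Pi.add_apply]
  rcases le_total 0 y with hy | hy
  · have h2 : (Ici 0).indicator (doubleExp a β) y = doubleExp a β y := indicator_of_mem hy _
    rw [abs_of_nonneg hy, h2]
    linarith [h0 (-y)]
  · have h2 : (Ici 0).indicator (doubleExp a β) (-y) = doubleExp a β (-y) :=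
      indicator_of_mem (neg_nonneg.2 hy) _
    rw [abs_of_nonpos hy, h2]
    linarith [h0 y]

theorem integral_exp_neg_mul_exp_abs_le {a β : ℝ} (ha : 0 < a) (hβ : 0 < β) :
    ∫ y : ℝ, Real.exp (-(a * Real.exp (β * |y|))) ≤ 2 * ((1 + max (-Real.log a) 0) / β) := by
  simp only [exp_neg_mul_exp]
  rw [integral_const_mul, integral_comp_abs (f := doubleExp a β)]
  have h := (integrableOn_doubleExp_and_integral_le ha hβ).2
  have h0 : 0 ≤ ∫ y in Ioi 0, doubleExp a β y :=
    integral_nonneg fun y => (doubleExp_pos _ _ _).le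
  have h1 : Real.exp (-a) ≤ 1 := Real.exp_le_one_iff.2 (by linarith)
  nlinarith

theorem isBigO_exp_neg_mul_exp_abs {a β : ℝ} (ha : 0 < a) (hβ : 0 < β) :
    (fun y : ℝ => Real.exp (-(a * Real.exp (β * |y|)))) =O[cocompact ℝ]
      fun y => |y| ^ (-2 : ℝ) := by
  have h1 : (fun y : ℝ => Real.exp (-(a * Real.exp (β * |y|)))) =O[cocompact ℝ]
      fun y => Real.exp (-(a * β) * |y|) := by
    refine .of_bound 1 (.of_forall fun y => ?_)
    rw [Real.norm_of_nonneg (Real.exp_pos _).le, Real.norm_of_nonneg (Real.exp_pos _).le, one_mul]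
    refine Real.exp_le_exp.2 ?_
    have := Real.add_one_le_exp (β * |y|)
    nlinarith
  refine h1.trans ?_
  exact ((isLittleO_exp_neg_mul_rpow_atTop (mul_pos ha hβ) (-2)).isBigO).comp_tendsto
    (tendsto_norm_cocompact_atTop (E := ℝ))

/-- The tail of the trapezoidal sum of a double exponential, estimated by the integral test. -/
theorem tsum_doubleExp_le {a β k X : ℝ} (ha : 0 < a) (hβ : 0 < β) (hk : 0 < k) (hX : 0 ≤ X) :
    Summable (fun n : ℕ => Real.exp (-(a * Real.exp (β * (X + (n + 1 : ℕ) * k))))) ∧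
    k * ∑' n : ℕ, Real.exp (-(a * Real.exp (β * (X + (n + 1 : ℕ) * k)))) ≤
      Real.exp (-(a * Real.exp (β * X))) * ((1 + max (-Real.log a) 0) / β) := by
  set s := Real.exp (-(a * Real.exp (β * X)))
  obtain ⟨hint, hle⟩ := integrableOn_doubleExp_and_integral_le ha hβ
  -- as `exp (β X) ≥ 1`, the quotient by the value at `X` is at most a normalized double exponential
  have hpt : ∀ n : ℕ, Real.exp (-(a * Real.exp (β * (X + (n + 1 : ℕ) * k)))) ≤
      s * doubleExp a β (k * (n + 1 : ℕ)) := by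
    intro n
    rw [doubleExp, ← Real.exp_add]
    refine Real.exp_le_exp.2 ?_
    rw [mul_add, Real.exp_add]
    have h1 : 1 ≤ Real.exp (β * X) := Real.one_le_exp (by positivity)
    have h2 : 1 ≤ Real.exp (β * ((n + 1 : ℕ) * k)) := Real.one_le_exp (by positivity)
    rw [mul_comm k]
    nlinarith [mul_nonneg ha.le (mul_nonneg (sub_nonneg.2 h1) (sub_nonneg.2 h2))]
  have hanti : AntitoneOn (fun y => doubleExp a β (k * y)) (Ici 0) := fun x _ y _ hxy =>
    antitone_doubleExp ha.le hβ.le (by gcongr)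
  have hint' : IntegrableOn (fun y => doubleExp a β (k * y)) (Ioi 0) := by
    rw [integrableOn_Ioi_comp_mul_left_iff (doubleExp a β) 0 hk]
    simpa using hint
  have hsum := hanti.summable_of_integrableOn_Ioi_zero hint' fun y _ => (doubleExp_pos _ _ _).le
  have hts := hanti.tsum_add_one_le_integral hint' fun y _ => (doubleExp_pos _ _ _).le
  rw [integral_comp_mul_left_Ioi _ _ hk, mul_zero, smul_eq_mul] at hts
  have hsum1 : Summable fun n : ℕ => doubleExp a β (k * (n + 1 : ℕ)) :=
    (summable_nat_add_iff 1).2 hsum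
  have hS : Summable (fun n : ℕ => Real.exp (-(a * Real.exp (β * (X + (n + 1 : ℕ) * k))))) :=
    .of_nonneg_of_le (fun n => (Real.exp_pos _).le) hpt (hsum1.mul_left s)
  refine ⟨hS, ?_⟩
  calc _ ≤ k * ∑' n : ℕ, s * doubleExp a β (k * (n + 1 : ℕ)) := by
        refine mul_le_mul_of_nonneg_left (hS.tsum_le_tsum hpt (hsum1.mul_left s)) hk.le
    _ = s * (k * ∑' n : ℕ, doubleExp a β (k * (n + 1 : ℕ))) := by rw [tsum_mul_left]; ring
    _ ≤ s * (k * (k⁻¹ * ∫ y in Ioi 0, doubleExp a β y)) := by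
        have : 0 ≤ s := (Real.exp_pos _).le
        gcongr
    _ = s * ∫ y in Ioi 0, doubleExp a β y := by rw [mul_inv_cancel_left₀ hk.ne']
    _ ≤ _ := by
        have : 0 ≤ s := (Real.exp_pos _).le
        gcongr

theorem log_one_sub_exp_neg_le {x : ℝ} (hx : 0 < x) :
    Real.log (1 - Real.exp (-x)) ≤ Real.log x := by
  have h1 : Real.exp (-x) < 1 := Real.exp_lt_one_iff.2 (by linarith)
  refine Real.log_le_log (by linarith) ?_
  have := Real.add_one_le_exp (-x)
  linarith

/-- The logarithmic factor in the double exponential integrals is at most `M(t)`. -/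
theorem one_add_max_neg_log_le_Mt {β b d t : ℝ} (hβ0 : 0 < β) (hβ1 : β < 1)
    (hκ : 0 < kap β b d) (ht : 0 < t) :
    1 + max (-Real.log (kap β b d * 2 ^ (-β) * t)) 0 ≤ Mt β b d t := by
  set x := kap β b d * t with hx
  have hx0 : 0 < x := by positivity
  have h1 : kap β b d * 2 ^ (-β) * t = 2 ^ (-β) * x := by rw [hx]; ring
  rw [h1, Real.log_mul (by positivity) hx0.ne', Real.log_rpow (by norm_num), Mt, calL]
  have h2 := log_one_sub_exp_neg_le hx0
  have h3 := neg_abs_le (Real.log (1 - Real.exp (-x)))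
  -- `-log (2 ^ (-β) x) = β log 2 - log x`, and `β log 2 ≤ 1`
  have h4 : Real.log 2 ≤ 1 := by linarith [Real.log_two_lt_d9]
  have h5 : 0 ≤ Real.log 2 := Real.log_nonneg (by norm_num)
  have h6 : max (-(-β * Real.log 2 + Real.log x)) 0 ≤ 1 + |Real.log (1 - Real.exp (-x))| := by
    refine max_le ?_ (by positivity)
    nlinarith
  linarith

theorem Mt_antitoneOn {β b d : ℝ} (hκ : 0 < kap β b d) : AntitoneOn (Mt β b d) (Ioi 0) := by
  intro s hs t _ hst
  have hs' : 0 < kap β b d * s := mul_pos hκ hs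
  have hst' : kap β b d * s ≤ kap β b d * t := by gcongr
  have key : ∀ x : ℝ, 0 < x → Real.log (1 - Real.exp (-x)) ≤ 0 := fun x hx => by
    have h1 : Real.exp (-x) < 1 := Real.exp_lt_one_iff.2 (by linarith)
    exact Real.log_nonpos (by linarith) (by linarith [Real.exp_pos (-x)])
  simp only [Mt, calL]
  rw [abs_of_nonpos (key _ hs'), abs_of_nonpos (key _ (hs'.trans_le hst'))]
  have h1 : Real.exp (-(kap β b d * s)) < 1 := Real.exp_lt_one_iff.2 (by linarith)
  have h2 : Real.exp (-(kap β b d * t)) ≤ Real.exp (-(kap β b d * s)) := Real.exp_le_exp.2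
    (by linarith)
  have := Real.log_le_log (by linarith)
    (by linarith : 1 - Real.exp (-(kap β b d * s)) ≤ 1 - Real.exp (-(kap β b d * t)))
  linarith

theorem continuous_gFun_line {β b d l : ℝ} (hb : 0 < b) (hd1 : d < Real.pi / 4) {lam t η : ℝ}
    (hlam : l ≤ lam) (hη : |η| ≤ d)
    (hK : ∀ lam x η : ℝ, l ≤ lam → |η| ≤ d → hypContour b (x + η * Complex.I) - lam ≠ 0) :
    Continuous fun x : ℝ => gFun β b lam t (x + η * Complex.I) := by
  refine (differentiableOn_gFun hb hd1 hlam hK).continuousOn.comp_continuous (by fun_prop)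
    fun x => ?_
  simpa using hη

theorem gLines_eq (β b d lam t y : ℝ) :
    gLines β b d lam t y = ‖gFun β b lam t (y + d * Complex.I)‖ +
      ‖gFun β b lam t (y + (-d : ℝ) * Complex.I)‖ := by
  rw [gLines]; push_cast; ring_nf

theorem continuous_gLines {β b d l : ℝ} (hb : 0 < b) (hd0 : 0 < d) (hd1 : d < Real.pi / 4)
    {lam t : ℝ} (hlam : l ≤ lam)
    (hK : ∀ lam x η : ℝ, l ≤ lam → |η| ≤ d → hypContour b (x + η * Complex.I) - lam ≠ 0) :
    Continuous (gLines β b d lam t) := by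
  rw [funext (gLines_eq β b d lam t)]
  exact (continuous_gFun_line hb hd1 hlam (abs_of_pos hd0).le hK).norm.add
    (continuous_gFun_line hb hd1 hlam (by rw [abs_neg, abs_of_pos hd0]) hK).norm

section

variable {β b d l K : ℝ} (hβ0 : 0 < β) (hβ1 : β < 1) (hb : 0 < b) (hd0 : 0 < d)
  (hd1 : d < Real.pi / 4)
  (hK : ∀ lam x η : ℝ, l ≤ lam → |η| ≤ d →
    hypContour b (x + η * Complex.I) - lam ≠ 0 ∧
    ‖deriv (hypContour b) (x + η * Complex.I)‖ ≤
      K * ‖hypContour b (x + η * Complex.I) - lam‖)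

include hβ0 hβ1 hb hd0 hd1 hK

theorem gLines_le {lam t : ℝ} (ht : 0 < t) (hlam : l ≤ lam) (y : ℝ) :
    gLines β b d lam t y ≤
      2 * K * Real.exp (-(kap β b d * 2 ^ (-β) * t * Real.exp (β * |y|))) := by
  rw [gLines_eq]
  have h1 := norm_gFun_le hβ0 hβ1 hb hd1 hK ht hlam (abs_of_pos hd0).le y
  have h2 := norm_gFun_le hβ0 hβ1 hb hd1 hK ht hlam (η := -d) (by rw [abs_neg, abs_of_pos hd0]) y
  linarith

theorem integrable_gLines {lam t : ℝ} (ht : 0 < t) (hlam : l ≤ lam) :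
    Integrable fun y : ℝ => gLines β b d lam t y := by
  have ha : 0 < kap β b d * 2 ^ (-β) * t := by
    have := kap_pos hβ0 hβ1 hb hd0 hd1
    positivity
  refine ((integrable_exp_neg_mul_exp_abs ha hβ0).const_mul (2 * K)).mono'
    (continuous_gLines hb hd0 hd1 hlam
      fun lam x η hl hη => (hK lam x η hl hη).1).aestronglyMeasurable (.of_forall fun y => ?_)
  rw [Real.norm_of_nonneg (by rw [gLines]; positivity)]
  exact gLines_le hβ0 hβ1 hb hd0 hd1 hK ht hlam y

theorem integral_gLines_le (hK0 : 0 < K) {lam t : ℝ} (ht : 0 < t) (hlam : l ≤ lam) :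
    ∫ y : ℝ, gLines β b d lam t y ≤ 4 * K / β * Mt β b d t := by
  have hκ := kap_pos hβ0 hβ1 hb hd0 hd1
  have ha : 0 < kap β b d * 2 ^ (-β) * t := by positivity
  calc _ ≤ ∫ y : ℝ, 2 * K * Real.exp (-(kap β b d * 2 ^ (-β) * t * Real.exp (β * |y|))) :=
        integral_mono (integrable_gLines hβ0 hβ1 hb hd0 hd1 hK ht hlam)
          ((integrable_exp_neg_mul_exp_abs ha hβ0).const_mul (2 * K))
          (gLines_le hβ0 hβ1 hb hd0 hd1 hK ht hlam)
    _ ≤ 2 * K * (2 * ((1 + max (-Real.log (kap β b d * 2 ^ (-β) * t)) 0) / β)) := by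
        rw [integral_const_mul]
        gcongr
        exact integral_exp_neg_mul_exp_abs_le ha hβ0
    _ ≤ 2 * K * (2 * (Mt β b d t / β)) := by
        gcongr
        exact one_add_max_neg_log_le_Mt hβ0 hβ1 hκ ht
    _ = _ := by ring

/-- The maximum over `λ` is attained, because the integral is continuous in `λ` and tends to `0`
as `λ → ∞`. -/
theorem isGreatest_Ndt {t : ℝ} (ht : 0 < t) :
    IsGreatest (gIntegrals β b l d t) (Ndt β b l d t) := by
  have ha : 0 < kap β b d * 2 ^ (-β) * t := by
    have := kap_pos hβ0 hβ1 hb hd0 hd1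
    positivity
  set Φ : ℝ → ℝ := fun lam => ∫ y : ℝ, gLines β b d lam t y with hΦ
  set B : ℝ → ℝ := fun y => 2 * K * Real.exp (-(kap β b d * 2 ^ (-β) * t * Real.exp (β * |y|)))
  have hB : Integrable B := (integrable_exp_neg_mul_exp_abs ha hβ0).const_mul (2 * K)
  have hbd : ∀ lam ∈ Ici l, ∀ y, ‖gLines β b d lam t y‖ ≤ B y := fun lam hlam y => by
    rw [Real.norm_of_nonneg (by rw [gLines]; positivity)]
    exact gLines_le hβ0 hβ1 hb hd0 hd1 hK ht hlam y
  have hmeas : ∀ lam ∈ Ici l, AEStronglyMeasurable (gLines β b d lam t) volume :=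
    fun lam hlam => (continuous_gLines hb hd0 hd1 hlam
      fun lam x η hl hη => (hK lam x η hl hη).1).aestronglyMeasurable
  have hcont : ContinuousOn Φ (Ici l) := by
    refine continuousOn_of_dominated (bound := B) hmeas
      (fun lam hlam => .of_forall (hbd lam hlam)) hB (.of_forall fun y => ?_)
    simp only [gLines_eq, gFun]
    have h1 : ∀ η : ℝ, |η| ≤ d → ContinuousOn
        (fun lam : ℝ => (hypContour b (y + η * Complex.I) - lam)⁻¹) (Ici l) := fun η hη =>
      ContinuousOn.inv₀ (by fun_prop) fun lam hlam => (hK lam y η hlam hη).1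
    exact (((continuousOn_const.mul (h1 d (abs_of_pos hd0).le)).mul continuousOn_const).norm).add
      (((continuousOn_const.mul (h1 (-d) (by rw [abs_neg, abs_of_pos hd0]))).mul
        continuousOn_const).norm)
  have hlim : Tendsto Φ atTop (𝓝 0) := by
    have h0 : (0 : ℝ) = ∫ _ : ℝ, (0 : ℝ) := by simp
    rw [h0]
    refine tendsto_integral_filter_of_dominated_convergence B
      ((eventually_ge_atTop l).mono hmeas)
      ((eventually_ge_atTop l).mono fun lam hlam => .of_forall (hbd lam hlam)) hB
      (.of_forall fun y => ?_)
    simp only [gLines_eq, gFun]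
    have h1 : ∀ w : ℂ, Tendsto (fun lam : ℝ => (w - lam)⁻¹) atTop (𝓝 0) := fun w => by
      refine tendsto_inv₀_cobounded.comp ?_
      rw [← tendsto_norm_atTop_iff_cobounded]
      refine tendsto_atTop_mono (fun lam => ?_)
        (tendsto_atTop_add_const_right atTop (-‖w‖) tendsto_id)
      have h2 := norm_sub_norm_le (lam : ℂ) w
      rw [norm_sub_rev, Complex.norm_real] at h2
      have h3 := Real.le_norm_self lam
      simp only [id]
      linarith
    have h2 : ∀ w p q : ℂ, Tendsto (fun lam : ℝ => ‖p * (w - lam)⁻¹ * q‖) atTop (𝓝 0) :=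
      fun w p q => by simpa using (((h1 w).const_mul p).mul_const q).norm
    simpa using (h2 _ _ _).add (h2 _ _ _)
  have hΦ0 : ∀ lam, 0 ≤ Φ lam := fun lam => integral_nonneg fun y => by
    simp only [gLines, Pi.zero_apply]; positivity
  obtain ⟨lam₀, hlam₀, hmax⟩ : ∃ lam₀ ∈ Ici l, ∀ lam ∈ Ici l, Φ lam ≤ Φ lam₀ := by
    by_cases hpos : ∃ lam ∈ Ici l, 0 < Φ lam
    · obtain ⟨lam₁, h1, h2⟩ := hpos
      refine hcont.exists_isMaxOn' isClosed_Ici h1 ?_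
      rw [cocompact_eq_atBot_atTop, inf_sup_right, eventually_sup]
      refine ⟨?_, ((hlim.eventually_lt_const h2).mono fun lam h => h.le).filter_mono inf_le_left⟩
      rw [eventually_inf_principal]
      exact (eventually_lt_atBot l).mono fun lam h h' => absurd h' (not_le.2 h)
    · push Not at hpos
      exact ⟨l, self_mem_Ici, fun lam hlam => (hpos lam hlam).trans (hΦ0 l)⟩
  have hg : IsGreatest (gIntegrals β b l d t) (Φ lam₀) :=
    ⟨⟨lam₀, hlam₀, rfl⟩, fun I ⟨lam, hlam, hI⟩ => hI ▸ hmax lam hlam⟩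
  rw [Ndt, hg.csSup_eq]
  exact hg

theorem Ndt_le (hK0 : 0 < K) {t : ℝ} (ht : 0 < t) :
    Ndt β b l d t ≤ 4 * K / β * Mt β b d t := by
  obtain ⟨lam, hlam, h⟩ := (isGreatest_Ndt hβ0 hβ1 hb hd0 hd1 hK ht).1
  rw [h]
  exact integral_gLines_le hβ0 hβ1 hb hd0 hd1 hK hK0 ht hlam

theorem Ndt_nonneg {t : ℝ} (ht : 0 < t) : 0 ≤ Ndt β b l d t := by
  obtain ⟨lam, -, h⟩ := (isGreatest_Ndt hβ0 hβ1 hb hd0 hd1 hK ht).1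
  rw [h]
  exact integral_nonneg fun y => by simp only [gLines, Pi.zero_apply]; positivity

end

/-! ### Cauchy's formula on the hyperbolic contour -/

theorem one_add_sq_le_cosh (x : ℝ) : (1 + x ^ 2) / 4 ≤ Real.cosh x := by
  have h := half_exp_abs_le_cosh x
  have h2 := Real.quadratic_le_exp_of_nonneg (abs_nonneg x)
  rw [sq_abs] at h2
  linarith [abs_nonneg x, sq_nonneg x]

theorem hypContour_ofReal (b y : ℝ) :
    (hypContour b y).re = b * Real.cosh y ∧ (hypContour b y).im = b * Real.sinh y := by
  rw [hypContour, ← Complex.ofReal_cosh, ← Complex.ofReal_sinh]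
  constructor <;>
    simp only [Complex.add_re, Complex.add_im, Complex.mul_re, Complex.mul_im, Complex.ofReal_re,
      Complex.ofReal_im, Complex.I_re, Complex.I_im] <;> ring

theorem integral_eq_zero_of_odd {f : ℝ → ℂ} (hf : ∀ x, f (-x) = -f x) : ∫ x, f x = 0 := by
  have h := integral_neg_eq_self f volume
  simp only [hf, integral_neg] at h
  exact self_eq_neg.1 h.symm

/-- The integral of `γ' (1 / (γ - λ) - 1 / (γ + λ))` over the contour. Its primitive is
`log ((λ - γ) / (γ + λ))`, and the argument of the logarithm, which is `-1 + 2 λ / (γ + λ)`,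
approaches `-1` from below as `y → ∞` and from above as `y → -∞`. -/
theorem integral_deriv_hypContour_mul {b lam : ℝ} (hb : 0 < b) (hlam : b < lam)
    (hint : Integrable fun y : ℝ => deriv (hypContour b) y *
      ((hypContour b y - lam)⁻¹ - (hypContour b y + lam)⁻¹)) :
    ∫ y : ℝ, deriv (hypContour b) y *
      ((hypContour b y - lam)⁻¹ - (hypContour b y + lam)⁻¹) = -(2 * Real.pi * Complex.I) := by
  have hl : 0 < lam := hb.trans hlam
  have hre : ∀ y : ℝ, 0 < (hypContour b y).re := fun y => by
    rw [(hypContour_ofReal b y).1]; have := Real.cosh_pos y; positivity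
  have hadd : ∀ y : ℝ, hypContour b y + lam ≠ 0 := fun y h => by
    have := congrArg Complex.re h
    simp only [Complex.add_re, Complex.ofReal_re, Complex.zero_re] at this
    linarith [hre y]
  set q : ℝ → ℂ := fun y => (lam - hypContour b y) / (hypContour b y + lam) with hq
  have hq' : ∀ y, q y = (2 * lam : ℝ) * (hypContour b y + lam)⁻¹ - 1 := fun y => by
    have := hadd y
    simp only [hq]; field_simp; push_cast; ring
  have him : ∀ y, (q y).im = -(2 * lam * b * Real.sinh y / Complex.normSq (hypContour b y + lam)) :=
    fun y => by
      rw [hq', Complex.sub_im, Complex.im_ofReal_mul, Complex.inv_im, Complex.add_im,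
        (hypContour_ofReal b y).2]
      simp only [Complex.ofReal_im, add_zero, Complex.one_im, sub_zero]
      ring
  have hns : ∀ y : ℝ, 0 < Complex.normSq (hypContour b y + lam) := fun y =>
    Complex.normSq_pos.2 (hadd y)
  have hslit : ∀ y, q y ∈ Complex.slitPlane := by
    intro y
    rw [Complex.mem_slitPlane_iff]
    by_cases hy : y = 0
    · left
      have h0 : hypContour b (y : ℝ) = b := by simp [hy, hypContour]
      have h1 : q y = ((lam - b) / (b + lam) : ℝ) := by simp only [hq]; rw [h0]; push_cast; rfl
      rw [h1, Complex.ofReal_re]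
      exact div_pos (by linarith) (by linarith)
    · right
      rw [him, neg_ne_zero]
      have : Real.sinh y ≠ 0 := Real.sinh_ne_zero.2 hy
      have := (hns y).ne'
      positivity
  have hne : ∀ y : ℝ, hypContour b y - lam ≠ 0 := fun y h => by
    have h1 : q y = 0 := by simp only [hq]; rw [← neg_sub, h]; simp
    exact Complex.slitPlane_ne_zero (hslit y) h1
  have hderiv : ∀ y : ℝ, HasDerivAt (fun y => Complex.log (q y)) (deriv (hypContour b) y *
      ((hypContour b y - lam)⁻¹ - (hypContour b y + lam)⁻¹)) y := by
    intro y
    have h1 : HasDerivAt (fun y : ℝ => hypContour b y) (deriv (hypContour b) y) y := by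
      have := (hasDerivAt_hypContour b y)
      rw [← deriv_hypContour] at this
      exact this.comp_ofReal
    have h2 := ((h1.const_sub (lam : ℂ)).div (h1.add_const (lam : ℂ)) (hadd y)).clog_real (hslit y)
    refine h2.congr_deriv ?_
    have e1 := hne y
    have e2 := hadd y
    have e3 : (lam : ℂ) - hypContour b y ≠ 0 := by rw [← neg_sub]; exact neg_ne_zero.2 e1
    have e4 : hypContour b y - lam = -(lam - hypContour b y) := (neg_sub _ _).symm
    rw [e4]
    simp only [Pi.div_apply]
    field_simp
  have hlimq : Tendsto q (cocompact ℝ) (𝓝 (-1)) := by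
    have h1 : Tendsto (fun y : ℝ => (hypContour b y + lam)⁻¹) (cocompact ℝ) (𝓝 0) := by
      refine tendsto_inv₀_cobounded.comp ?_
      rw [← tendsto_norm_atTop_iff_cobounded]
      refine tendsto_atTop_mono (f := fun y : ℝ => b / 4 * ‖y‖ ^ 2) (fun y => ?_) ?_
      · refine le_trans ?_ (Complex.re_le_norm _)
        rw [Complex.add_re, Complex.ofReal_re, (hypContour_ofReal b y).1, Real.norm_eq_abs, sq_abs]
        have := one_add_sq_le_cosh y
        nlinarith
      · exact ((tendsto_pow_atTop two_ne_zero).comp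
          (tendsto_norm_cocompact_atTop (E := ℝ))).const_mul_atTop (by positivity)
    have h2 := (h1.const_mul ((2 * lam : ℝ) : ℂ)).sub_const 1
    rw [mul_zero, zero_sub] at h2
    exact h2.congr fun y => (hq' y).symm
  have htop : Tendsto (fun y => Complex.log (q y)) atTop (𝓝 (-(Real.pi * Complex.I))) := by
    have h := Complex.tendsto_log_nhdsWithin_im_neg_of_re_neg_of_im_zero (z := -1) (by simp)
      (by simp)
    simp only [norm_neg, norm_one, Real.log_one, Complex.ofReal_zero, zero_sub] at h
    refine h.comp (tendsto_nhdsWithin_iff.2 ⟨hlimq.mono_left ?_, ?_⟩)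
    · rw [cocompact_eq_atBot_atTop]; exact le_sup_right
    · filter_upwards [eventually_gt_atTop 0] with y hy
      have h1 : 0 < Real.sinh y := Real.sinh_pos_iff.2 hy
      have h2 := hns y
      rw [him]
      have : 0 < 2 * lam * b * Real.sinh y / Complex.normSq (hypContour b y + lam) := by positivity
      linarith
  have hbot : Tendsto (fun y => Complex.log (q y)) atBot (𝓝 (Real.pi * Complex.I)) := by
    have h := Complex.tendsto_log_nhdsWithin_im_nonneg_of_re_neg_of_im_zero (z := -1) (by simp)
      (by simp)
    simp only [norm_neg, norm_one, Real.log_one, Complex.ofReal_zero, zero_add] at h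
    refine h.comp (tendsto_nhdsWithin_iff.2 ⟨hlimq.mono_left ?_, ?_⟩)
    · rw [cocompact_eq_atBot_atTop]; exact le_sup_left
    · filter_upwards [eventually_lt_atBot 0] with y hy
      have h1 : 0 < -Real.sinh y := by linarith [Real.sinh_neg_iff.2 hy]
      have h2 := hns y
      rw [him, ← neg_div, ← mul_neg]
      positivity
  rw [integral_of_hasDerivAt_of_tendsto hderiv hint hbot htop]
  ring

/-- The integrand of Cauchy's formula with the pole at `λ` removed, in the variable
`ζ = z + iπ/4`, in which the contour is `c cosh ζ`. -/
def regularPart (β c lam t : ℝ) (ζ : ℂ) : ℂ :=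
  (dslope (fun w : ℂ => Complex.exp (-t * w ^ (β : ℂ))) lam (c * Complex.cosh ζ) +
    Real.exp (-t * lam ^ β) * (c * Complex.cosh ζ + lam)⁻¹) * (c * Complex.sinh ζ)

/-- The regular part is odd, because `cosh` is even and `sinh` is odd. -/
theorem regularPart_neg (β c lam t : ℝ) (ζ : ℂ) :
    regularPart β c lam t (-ζ) = -regularPart β c lam t ζ := by
  simp [regularPart]

/-- Away from the pole the regular part is the difference of the integrand of Cauchy's formula and
of `exp (-t λ^β)` times the integrand of `integral_deriv_hypContour_mul`; the summand with pole
`-λ`, outside the right half plane, only makes the latter integrable. -/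
theorem regularPart_eq {β c lam t : ℝ} (hlam : 0 < lam) {ζ : ℂ}
    (h : c * Complex.cosh ζ - lam ≠ 0) :
    regularPart β c lam t ζ =
      Complex.exp (-t * (c * Complex.cosh ζ) ^ (β : ℂ)) * (c * Complex.cosh ζ - lam)⁻¹ *
        (c * Complex.sinh ζ) -
      Real.exp (-t * lam ^ β) * ((c * Complex.sinh ζ) *
        ((c * Complex.cosh ζ - lam)⁻¹ - (c * Complex.cosh ζ + lam)⁻¹)) := by
  have h1 : Complex.exp (-t * (lam : ℂ) ^ (β : ℂ)) = (Real.exp (-t * lam ^ β) : ℝ) := by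
    rw [Complex.ofReal_exp]; push_cast [Complex.ofReal_cpow hlam.le]; rfl
  rw [regularPart, dslope_of_ne _ (sub_ne_zero.1 h), slope_def_field, h1]
  field_simp
  ring

theorem cosh_re_pos {c θ : ℝ} (hc : 0 < c) (hθ : |θ| < Real.pi / 2) (x : ℝ) :
    0 < ((c : ℂ) * Complex.cosh (x + θ * Complex.I)).re := by
  rw [Complex.re_ofReal_mul, cosh_add_mul_I_re]
  have := abs_lt.1 hθ
  have h2 : 0 < Real.cos θ := Real.cos_pos_of_mem_Ioo ⟨by linarith, by linarith⟩
  have := Real.cosh_pos x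
  positivity

theorem differentiableOn_regularPart {β c lam t : ℝ} (hc : 0 < c) (hlam : 0 < lam) :
    DifferentiableOn ℂ (regularPart β c lam t) {ζ | |ζ.im| < Real.pi / 2} := by
  have hopen : IsOpen {w : ℂ | 0 < w.re} := isOpen_lt continuous_const Complex.continuous_re
  have h1 : DifferentiableOn ℂ (dslope (fun w : ℂ => Complex.exp (-t * w ^ (β : ℂ))) lam)
      {w | 0 < w.re} := by
    refine (Complex.differentiableOn_dslope (hopen.mem_nhds (by simpa using hlam))).2 ?_
    intro w hw
    exact (((differentiableAt_id.cpow_const (.inl hw)).const_mul _).cexp).differentiableWithinAt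
  intro ζ hζ
  have hre := cosh_re_pos hc hζ ζ.re
  rw [Complex.re_add_im] at hre
  have h2 := (h1 _ hre).differentiableAt (hopen.mem_nhds hre)
  have hne : (c : ℂ) * Complex.cosh ζ + lam ≠ 0 := fun h => by
    have := congrArg Complex.re h
    simp only [Complex.add_re, Complex.ofReal_re, Complex.zero_re] at this
    linarith
  refine DifferentiableAt.differentiableWithinAt ?_
  unfold regularPart
  refine DifferentiableAt.mul (DifferentiableAt.add ?_ ?_) (by fun_prop)
  · exact DifferentiableAt.fun_comp' ζ h2 (by fun_prop)
  · have h3 : DifferentiableAt ℂ (fun ζ : ℂ => (c : ℂ) * Complex.cosh ζ + lam) ζ := by fun_prop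
    exact (h3.inv hne).const_mul _

/-- In the strip `0 ≤ Im ζ ≤ π / 4` the regular part is dominated by an integrable function of
`Re ζ`. -/
theorem exists_norm_regularPart_le {β c lam t : ℝ} (hβ0 : 0 < β) (hβ1 : β < 1) (hc : 0 < c)
    (hlam : 0 < lam) (ht : 0 < t) :
    ∃ a C₁ C₂ : ℝ, 0 < a ∧ ∀ x θ : ℝ, θ ∈ uIcc 0 (Real.pi / 4) →
      ‖regularPart β c lam t (x + θ * Complex.I)‖ ≤
        C₁ * Real.exp (-(a * Real.exp (β * |x|))) + C₂ * (1 + x ^ 2)⁻¹ := by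
  have hpi := Real.pi_pos
  have hcos4 : 0 < Real.cos (Real.pi / 4) := Real.cos_pos_of_mem_Ioo ⟨by linarith, by linarith⟩
  set m := Real.cos (Real.pi / 4) with hm
  set κ := Real.cos (β * (Real.pi / 4)) * (c * m) ^ β with hκ
  have hκ0 : 0 < κ := by
    have h1 : 0 < Real.cos (β * (Real.pi / 4)) :=
      Real.cos_pos_of_mem_Ioo ⟨by nlinarith, by nlinarith⟩
    positivity
  set E := Real.exp (-t * lam ^ β) with hE
  have hE0 : 0 < E := Real.exp_pos _
  -- for `x ^ 2 > R` the real part of `c cosh ζ` exceeds `2 λ`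
  set R := 8 * lam / (c * m) with hR
  -- on the compact part of the strip the function is bounded
  obtain ⟨M, hM⟩ : ∃ M : ℝ, ∀ x θ : ℝ, x ^ 2 ≤ R → θ ∈ uIcc 0 (Real.pi / 4) →
      ‖regularPart β c lam t (x + θ * Complex.I)‖ ≤ M := by
    have hcomp : IsCompact (Icc (-√R) √R ×ˢ uIcc 0 (Real.pi / 4)) :=
      isCompact_Icc.prod isCompact_uIcc
    have hcont : ContinuousOn (fun p : ℝ × ℝ => regularPart β c lam t (p.1 + p.2 * Complex.I))
        (Icc (-√R) √R ×ˢ uIcc 0 (Real.pi / 4)) := by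
      refine (differentiableOn_regularPart hc hlam).continuousOn.comp (by fun_prop) ?_
      rintro ⟨x, θ⟩ ⟨-, hθ⟩
      rw [uIcc_of_le (by positivity)] at hθ
      simp only [mem_ofPred_eq, Complex.add_im, Complex.ofReal_im, Complex.mul_im, Complex.I_im,
        Complex.ofReal_re, Complex.I_re, mul_zero, mul_one, add_zero, zero_add]
      rw [abs_of_nonneg hθ.1]
      linarith [hθ.2]
    obtain ⟨M, hM⟩ := hcomp.exists_bound_of_continuousOn hcont
    refine ⟨M, fun x θ hx hθ => hM (x, θ) ⟨?_, hθ⟩⟩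
    exact abs_le.1 (Real.abs_le_sqrt hx)
  refine ⟨t * κ * 2 ^ (-β), 2 / m, 16 * lam * E / (c * m ^ 2) + |M| * (1 + R), by positivity,
    fun x θ hθ => ?_⟩
  have hx0 : 0 < 1 + x ^ 2 := by positivity
  rcases le_or_gt (x ^ 2) R with hx | hx
  · refine (hM x θ hx hθ).trans ?_
    have h1 : M ≤ |M| * (1 + R) * (1 + x ^ 2)⁻¹ := by
      rw [← div_eq_mul_inv, le_div_iff₀ hx0]
      nlinarith [le_abs_self M, abs_nonneg M]
    have h2 : 0 ≤ 2 / m * Real.exp (-(t * κ * 2 ^ (-β) * Real.exp (β * |x|))) := by positivity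
    have h3 : 0 ≤ 16 * lam * E / (c * m ^ 2) * (1 + x ^ 2)⁻¹ := by positivity
    rw [add_mul]
    linarith
  · rw [uIcc_of_le (by positivity)] at hθ
    have hθ' : |θ| ≤ Real.pi / 4 := by rw [abs_of_nonneg hθ.1]; exact hθ.2
    set w : ℂ := c * Complex.cosh (x + θ * Complex.I) with hw
    set v : ℂ := c * Complex.sinh (x + θ * Complex.I) with hv
    have hch := Real.cosh_pos x
    have hch2 := one_add_sq_le_cosh x
    have hcosθ : m ≤ Real.cos θ := by
      rw [← Real.cos_abs θ]
      exact Real.cos_le_cos_of_nonneg_of_le_pi (abs_nonneg θ) (by linarith) hθ'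
    have hre : c * m * Real.cosh x ≤ w.re := by
      rw [hw, Complex.re_ofReal_mul, cosh_add_mul_I_re]
      nlinarith [mul_le_mul_of_nonneg_left hcosθ (mul_pos hc hch).le]
    have hlarge : 2 * lam ≤ c * m * Real.cosh x := by
      rw [hR, div_lt_iff₀ (by positivity)] at hx
      nlinarith [mul_le_mul_of_nonneg_left hch2 (mul_pos hc hcos4).le, mul_pos hc hcos4]
    have hsub : c * m * Real.cosh x / 2 ≤ ‖w - lam‖ := by
      refine le_trans ?_ (Complex.re_le_norm _)
      rw [Complex.sub_re, Complex.ofReal_re]; linarith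
    have hadd : c * m * Real.cosh x ≤ ‖w + lam‖ := by
      refine le_trans ?_ (Complex.re_le_norm _)
      rw [Complex.add_re, Complex.ofReal_re]; linarith
    have hpos : 0 < c * m * Real.cosh x := by positivity
    have hv' : ‖v‖ ≤ c * Real.cosh x := by
      rw [hv, norm_mul, Complex.norm_real, Real.norm_of_nonneg hc.le]
      exact mul_le_mul_of_nonneg_left (norm_sinh_le x θ) hc.le
    have hne : w - lam ≠ 0 := norm_pos_iff.1 (by linarith)
    have hne' : w + lam ≠ 0 := norm_pos_iff.1 (by linarith)
    have hvs : ‖(w - lam)⁻¹‖ * ‖v‖ ≤ 2 / m := by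
      rw [norm_inv, inv_mul_le_iff₀ (by linarith)]
      calc ‖v‖ ≤ c * Real.cosh x := hv'
        _ = c * m * Real.cosh x / 2 * (2 / m) := by field_simp
        _ ≤ _ := by gcongr
    have hva : ‖(w + lam)⁻¹‖ ≤ 4 / (c * m) * (1 + x ^ 2)⁻¹ := by
      rw [norm_inv, div_mul_eq_mul_div, ← div_eq_mul_inv, div_div, ← inv_div]
      refine inv_anti₀ (by positivity) ?_
      nlinarith [mul_le_mul_of_nonneg_left hch2 (mul_pos hc hcos4).le]
    have hexp : ‖Complex.exp (-t * w ^ (β : ℂ))‖ ≤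
        Real.exp (-(t * κ * 2 ^ (-β) * Real.exp (β * |x|))) := by
      rw [Complex.norm_exp]
      refine Real.exp_le_exp.2 ?_
      rw [← Complex.ofReal_neg, Complex.re_ofReal_mul]
      have h1 := le_re_cosh_cpow hc hβ0 hβ1 hθ' (by linarith) x
      have h2 := mul_le_mul_of_nonneg_left (exp_abs_rpow_le_cosh_rpow hβ0 x) hκ0.le
      rw [← hw, ← hm, ← hκ] at h1
      have h3 := mul_le_mul_of_nonneg_left (h2.trans h1) ht.le
      linarith
    rw [regularPart_eq hlam hne, ← hw, ← hv]
    have hdiff : (w - lam)⁻¹ - (w + lam)⁻¹ = 2 * lam * ((w - lam)⁻¹ * (w + lam)⁻¹) := by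
      field_simp; ring
    rw [hdiff]
    calc _ ≤ ‖Complex.exp (-t * w ^ (β : ℂ)) * (w - lam)⁻¹ * v‖ +
          ‖(E : ℂ) * (v * (2 * lam * ((w - lam)⁻¹ * (w + lam)⁻¹)))‖ := norm_sub_le _ _
      _ = ‖Complex.exp (-t * w ^ (β : ℂ))‖ * (‖(w - lam)⁻¹‖ * ‖v‖) +
          E * (2 * lam) * ((‖(w - lam)⁻¹‖ * ‖v‖) * ‖(w + lam)⁻¹‖) := by
        simp only [norm_mul, Complex.norm_real, Real.norm_of_nonneg hE0.le,
          Real.norm_of_nonneg hlam.le, Complex.norm_ofNat]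
        ring
      _ ≤ Real.exp (-(t * κ * 2 ^ (-β) * Real.exp (β * |x|))) * (2 / m) +
          E * (2 * lam) * (2 / m * (4 / (c * m) * (1 + x ^ 2)⁻¹)) := by
        gcongr
      _ = 2 / m * Real.exp (-(t * κ * 2 ^ (-β) * Real.exp (β * |x|))) +
          16 * lam * E / (c * m ^ 2) * (1 + x ^ 2)⁻¹ := by
        field_simp; ring
      _ ≤ _ := by
        have : 0 ≤ |M| * (1 + R) * (1 + x ^ 2)⁻¹ := by
          have : 0 ≤ R := by positivity
          positivity
        rw [add_mul]
        linarith

/-- **Cauchy's formula** on the contour `γ`. After the pole at `λ` is removed the integrand is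
holomorphic to the right of the contour and an odd function of `ζ = z + iπ/4`, so that its integral,
shifted to `Im ζ = 0`, vanishes. -/
theorem integral_gFun {β b lam t : ℝ} (hβ0 : 0 < β) (hβ1 : β < 1) (hb : 0 < b)
    (hlam : √2 * b < lam) (ht : 0 < t) (hint : Integrable fun y : ℝ => gFun β b lam t y) :
    ∫ y : ℝ, gFun β b lam t y =
      -(2 * Real.pi * Complex.I) * (Real.exp (-t * lam ^ β) : ℝ) := by
  have hpi := Real.pi_pos
  have hc : 0 < √2 * b := by positivity
  have hl : 0 < lam := hc.trans hlam
  have hbl : b < lam := by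
    have h2 : 1 ≤ √2 := Real.one_le_sqrt.2 (by norm_num)
    nlinarith
  obtain ⟨a, C₁, C₂, ha, hbound⟩ := exists_norm_regularPart_le hβ0 hβ1 hc hl ht
  set B : ℝ → ℝ := fun x => C₁ * Real.exp (-(a * Real.exp (β * |x|))) + C₂ * (1 + x ^ 2)⁻¹
  have hB : Integrable B :=
    ((integrable_exp_neg_mul_exp_abs ha hβ0).const_mul C₁).add
      (integrable_inv_one_add_sq.const_mul C₂)
  have hsq : Tendsto (fun x : ℝ => (1 + x ^ 2)⁻¹) (cocompact ℝ) (𝓝 0) := by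
    refine tendsto_inv_atTop_zero.comp (tendsto_atTop_add_const_left _ 1 ?_)
    have := (tendsto_pow_atTop two_ne_zero).comp (tendsto_norm_cocompact_atTop (E := ℝ))
    refine this.congr fun x => ?_
    simp
  have hB0 : Tendsto B (cocompact ℝ) (𝓝 0) := by
    have h1 : Tendsto (fun x : ℝ => Real.exp (-(a * Real.exp (β * |x|)))) (cocompact ℝ) (𝓝 0) :=
      (isBigO_exp_neg_mul_exp_abs ha hβ0).trans_tendsto
        ((tendsto_rpow_neg_atTop (y := 2) (by norm_num)).comp
          (tendsto_norm_cocompact_atTop (E := ℝ)))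
    simpa using (h1.const_mul C₁).add (hsq.const_mul C₂)
  have hdiff : DifferentiableOn ℂ (regularPart β (√2 * b) lam t)
      (Complex.im ⁻¹' uIcc 0 (Real.pi / 4)) := by
    refine (differentiableOn_regularPart hc hl).mono fun ζ hζ => ?_
    rw [mem_preimage, uIcc_of_le (by positivity)] at hζ
    rw [mem_ofPred_eq, abs_of_nonneg hζ.1]
    linarith [hζ.2]
  have hshift := integral_line_eq_integral_line hdiff hB hB0 hbound
  have hodd : ∫ x : ℝ, regularPart β (√2 * b) lam t (x + (0 : ℝ) * Complex.I) = 0 := by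
    refine integral_eq_zero_of_odd fun x => ?_
    rw [← regularPart_neg]
    congr 1
    simp
  rw [hodd] at hshift
  have hne : ∀ y : ℝ, hypContour b y - lam ≠ 0 := fun y h => by
    have h1 := congrArg Complex.im h
    have h2 := congrArg Complex.re h
    simp only [Complex.sub_im, Complex.sub_re, Complex.ofReal_im, Complex.ofReal_re, sub_zero,
      Complex.zero_re, Complex.zero_im, (hypContour_ofReal b y).1,
      (hypContour_ofReal b y).2] at h1 h2
    have h3 : y = 0 := by simpa [hb.ne'] using h1
    rw [h3, Real.cosh_zero] at h2
    linarith
  set E : ℂ := ((Real.exp (-t * lam ^ β) : ℝ) : ℂ) with hE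
  have hE0 : E ≠ 0 := Complex.ofReal_ne_zero.2 (Real.exp_pos _).ne'
  have hreg : ∀ x : ℝ, regularPart β (√2 * b) lam t (x + (Real.pi / 4 : ℝ) * Complex.I) =
      gFun β b lam t x - E * (deriv (hypContour b) x *
        ((hypContour b x - lam)⁻¹ - (hypContour b x + lam)⁻¹)) := by
    intro x
    have := hne x
    rw [hypContour_eq_cosh] at this
    rw [regularPart_eq hl this, gFun, hypContour_eq_cosh, deriv_hypContour]
  have hintR : Integrable fun x : ℝ =>
      regularPart β (√2 * b) lam t (x + (Real.pi / 4 : ℝ) * Complex.I) :=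
    integrable_strip_line hdiff.continuousOn hB hbound right_mem_uIcc
  have hintL : Integrable fun y : ℝ => deriv (hypContour b) y *
      ((hypContour b y - lam)⁻¹ - (hypContour b y + lam)⁻¹) := by
    refine ((hint.sub hintR).const_mul E⁻¹).congr (.of_forall fun x => ?_)
    simp only [Pi.sub_apply, hreg, sub_sub_cancel]
    rw [inv_mul_cancel_left₀ hE0]
  simp only [hreg] at hshift
  rw [integral_sub hint (hintL.const_mul E), integral_const_mul,
    integral_deriv_hypContour_mul hb hbl hintL] at hshift
  linear_combination -hshift

/-! ### The quadrature error for a single eigenvalue -/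

theorem sum_Icc_neg_eq {E : Type*} [AddCommGroup E] (f : ℤ → E) (N : ℕ) :
    ∑ j ∈ Finset.Icc (-(N : ℤ)) N, f j =
      (∑ n ∈ Finset.range N, f (n + 1)) + f 0 + ∑ n ∈ Finset.range N, f (-(n + 1)) := by
  induction N with
  | zero => simp
  | succ N ih =>
    have h : Finset.Icc (-((N + 1 : ℕ) : ℤ)) (N + 1 : ℕ) =
        insert ((N : ℤ) + 1) (insert (-((N : ℤ) + 1)) (Finset.Icc (-(N : ℤ)) N)) := by
      ext j
      simp only [Finset.mem_Icc, Finset.mem_insert]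
      omega
    rw [h, Finset.sum_insert (by simp only [Finset.mem_insert, Finset.mem_Icc]; omega),
      Finset.sum_insert (by simp only [Finset.mem_Icc]; omega), ih, Finset.sum_range_succ,
      Finset.sum_range_succ]
    abel

theorem tsum_int_sub_sum_Icc {f : ℤ → ℂ} (hf : Summable f) (N : ℕ) :
    ∑' j, f j - ∑ j ∈ Finset.Icc (-(N : ℤ)) N, f j =
      (∑' n : ℕ, f ((n + N : ℕ) + 1)) + ∑' n : ℕ, f (-((n + N : ℕ) + 1)) := by
  have h1 : Summable fun n : ℕ => f (n + 1) :=
    hf.comp_injective (i := fun n : ℕ => (n : ℤ) + 1) fun a b h => by simpa using h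
  have h2 : Summable fun n : ℕ => f (-(n + 1)) :=
    hf.comp_injective (i := fun n : ℕ => -((n : ℤ) + 1)) fun a b h => by simpa using h
  rw [tsum_of_add_one_of_neg_add_one h1 h2, sum_Icc_neg_eq, ← h1.sum_add_tsum_nat_add N,
    ← h2.sum_add_tsum_nat_add N]
  ring

/-- The quadrature error for `exp (-t λ^β)`: by Cauchy's formula it is the error of the truncated
trapezoidal rule for the integral of `g_λ(·, t)`. -/
theorem norm_exp_sub_quadrature_le {β b d l K : ℝ} (hβ0 : 0 < β) (hβ1 : β < 1) (hb : 0 < b)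
    (hd0 : 0 < d) (hd1 : d < Real.pi / 4) (hl : √2 * b < l) (hK0 : 0 < K)
    (hK : ∀ lam x η : ℝ, l ≤ lam → |η| ≤ d →
      hypContour b (x + η * Complex.I) - lam ≠ 0 ∧
      ‖deriv (hypContour b) (x + η * Complex.I)‖ ≤
        K * ‖hypContour b (x + η * Complex.I) - lam‖)
    {lam t k : ℝ} (hlam : l ≤ lam) (ht : 0 < t) (hk : 0 < k) {N : ℕ} (hN : 1 ≤ N) :
    ‖(Real.exp (-t * lam ^ β) : ℂ) + (k : ℂ) / (2 * Real.pi * Complex.I) *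
        ∑ j ∈ Finset.Icc (-(N : ℤ)) N, gFun β b lam t ((j : ℂ) * k)‖ ≤
      (1 + 2 * K / β) * (Ndt β b l d t / (Real.exp (2 * Real.pi * d / k) - 1) +
        Mt β b d t * (Real.cosh (k * N) / Real.sinh (k * N)) *
          Real.exp (-(kap β b d) * 2 ^ (-β) * t * Real.exp (k * N * β))) := by
  have hκ := kap_pos hβ0 hβ1 hb hd0 hd1
  set a := kap β b d * 2 ^ (-β) * t with ha
  have ha0 : 0 < a := by positivity
  set B : ℝ → ℝ := fun x => K * Real.exp (-(a * Real.exp (β * |x|))) with hB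
  have hstrip : ∀ y : ℝ, y ∈ uIcc (-d) d → |y| ≤ d := fun y hy => by
    rw [uIcc_of_le (by linarith)] at hy
    exact abs_le.2 hy
  have hbound : ∀ x y : ℝ, y ∈ uIcc (-d) d → ‖gFun β b lam t (x + y * Complex.I)‖ ≤ B x :=
    fun x y hy => norm_gFun_le hβ0 hβ1 hb hd1 hK ht hlam (hstrip y hy) x
  have hdiff : DifferentiableOn ℂ (gFun β b lam t) (Complex.im ⁻¹' uIcc (-d) d) :=
    (differentiableOn_gFun hb hd1 hlam fun lam x η h1 h2 => (hK lam x η h1 h2).1).mono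
      fun z hz => hstrip _ hz
  have hBint : Integrable B := (integrable_exp_neg_mul_exp_abs ha0 hβ0).const_mul K
  have hBO : B =O[cocompact ℝ] fun x => |x| ^ (-2 : ℝ) :=
    (isBigO_exp_neg_mul_exp_abs ha0 hβ0).const_mul_left K
  have h0 : (0 : ℝ) ∈ uIcc (-d) d := by rw [uIcc_of_le (by linarith)]; constructor <;> linarith
  have hreal : ∀ x : ℝ, ‖gFun β b lam t x‖ ≤ B x := fun x => by simpa using hbound x 0 h0
  have hint : Integrable fun x : ℝ => gFun β b lam t x := by
    simpa using integrable_strip_line hdiff.continuousOn hBint hbound h0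
  obtain ⟨hsum, htrap⟩ := norm_integral_sub_tsum_le hd0 hk hdiff hBint hBO hbound
  have hcauchy := integral_gFun hβ0 hβ1 hb (hl.trans_le hlam) ht hint
  have hgI : (∫ y : ℝ, ‖gFun β b lam t (y + d * Complex.I)‖ +
      ‖gFun β b lam t (y - d * Complex.I)‖) ≤ Ndt β b l d t :=
    (isGreatest_Ndt hβ0 hβ1 hb hd0 hd1 hK ht).2 ⟨lam, hlam, rfl⟩
  have hexp1 : 0 < Real.exp (2 * Real.pi * d / k) - 1 := by
    have : 1 < Real.exp (2 * Real.pi * d / k) :=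
      Real.one_lt_exp_iff.2 (by have := Real.pi_pos; positivity)
    linarith
  have htrap' : ‖(∫ x : ℝ, gFun β b lam t x) - k * ∑' j : ℤ, gFun β b lam t ((j : ℂ) * k)‖ ≤
      Ndt β b l d t / (Real.exp (2 * Real.pi * d / k) - 1) :=
    htrap.trans (by gcongr)
  -- the two tails of the trapezoidal sum
  have hX : 0 < k * N := by
    have : (0 : ℝ) < N := by exact_mod_cast hN
    positivity
  obtain ⟨htS, htle⟩ := tsum_doubleExp_le ha0 hβ0 hk hX.le
  set T := ∑' n : ℕ, Real.exp (-(a * Real.exp (β * (k * N + (n + 1 : ℕ) * k))))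
  set e := Real.exp (-(a * Real.exp (β * (k * N)))) with he
  have htail : ∀ s : ℤ, |(s : ℝ)| = 1 →
      ‖∑' n : ℕ, gFun β b lam t (((s * ((n + N : ℕ) + 1) : ℤ) : ℂ) * k)‖ ≤ K * T := by
    intro s hs
    refine tsum_of_norm_bounded (htS.hasSum.mul_left K) fun n => ?_
    have h1 := hreal ((s * ((n + N : ℕ) + 1) : ℤ) * k)
    have h2 : |(((s * ((n + N : ℕ) + 1) : ℤ) : ℝ)) * k| = k * N + (n + 1 : ℕ) * k := by
      push_cast
      rw [abs_mul, abs_mul, hs, abs_of_pos hk, abs_of_pos (by positivity)]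
      ring
    simp only [hB, h2] at h1
    simpa using h1
  have hdiffsum : ‖(k : ℂ) * (∑' j : ℤ, gFun β b lam t ((j : ℂ) * k) -
      ∑ j ∈ Finset.Icc (-(N : ℤ)) N, gFun β b lam t ((j : ℂ) * k))‖ ≤
      2 * K / β * (Mt β b d t * e) := by
    rw [tsum_int_sub_sum_Icc hsum N]
    have h1 := htail 1 (by simp)
    have h2 := htail (-1) (by simp)
    simp only [one_mul, neg_mul] at h1 h2
    have h3 := one_add_max_neg_log_le_Mt hβ0 hβ1 hκ ht
    rw [norm_mul, Complex.norm_real, Real.norm_of_nonneg hk.le]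
    calc _ ≤ k * (K * T + K * T) := by
          gcongr
          exact (norm_add_le _ _).trans (add_le_add h1 h2)
      _ = 2 * K * (k * T) := by ring
      _ ≤ 2 * K * (e * ((1 + max (-Real.log a) 0) / β)) := by gcongr
      _ ≤ 2 * K * (e * (Mt β b d t / β)) := by
          have : 0 ≤ e := (Real.exp_pos _).le
          gcongr
      _ = _ := by ring
  have hcoth : 1 ≤ Real.cosh (k * N) / Real.sinh (k * N) := by
    rw [one_le_div (Real.sinh_pos_iff.2 hX)]
    exact (Real.sinh_lt_cosh _).le
  have hM0 : 0 ≤ Mt β b d t := by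
    rw [Mt, calL]; positivity
  have hpi : (2 * Real.pi * Complex.I : ℂ) ≠ 0 := by
    simp [Real.pi_ne_zero]
  have hsplit : (Real.exp (-t * lam ^ β) : ℂ) + (k : ℂ) / (2 * Real.pi * Complex.I) *
        ∑ j ∈ Finset.Icc (-(N : ℤ)) N, gFun β b lam t ((j : ℂ) * k) =
      -(2 * Real.pi * Complex.I)⁻¹ *
        (((∫ x : ℝ, gFun β b lam t x) - k * ∑' j : ℤ, gFun β b lam t ((j : ℂ) * k)) +
        (k : ℂ) * (∑' j : ℤ, gFun β b lam t ((j : ℂ) * k) -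
          ∑ j ∈ Finset.Icc (-(N : ℤ)) N, gFun β b lam t ((j : ℂ) * k))) := by
    rw [hcauchy]
    field_simp
    ring
  have hinv : ‖-(2 * Real.pi * Complex.I : ℂ)⁻¹‖ ≤ 1 := by
    rw [norm_neg, norm_inv]
    refine inv_le_one_of_one_le₀ ?_
    simp only [norm_mul, Complex.norm_I, Complex.norm_real, Real.norm_of_nonneg Real.pi_pos.le,
      Complex.norm_ofNat]
    linarith [Real.pi_gt_three]
  have hexpe : Real.exp (-(kap β b d) * 2 ^ (-β) * t * Real.exp (k * N * β)) = e := by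
    rw [he, ha]; congr 1; rw [mul_comm β]; ring
  rw [hsplit, hexpe, norm_mul]
  set P := Ndt β b l d t / (Real.exp (2 * Real.pi * d / k) - 1)
  set c := Real.cosh (k * N) / Real.sinh (k * N)
  have hP : 0 ≤ P := (norm_nonneg _).trans htrap'
  have he0 : 0 ≤ Mt β b d t * e := mul_nonneg hM0 (Real.exp_pos _).le
  have hKβ : 0 ≤ 2 * K / β := by positivity
  calc _ ≤ 1 * (P + 2 * K / β * (Mt β b d t * e)) :=
        mul_le_mul hinv ((norm_add_le _ _).trans (add_le_add htrap' hdiffsum)) (norm_nonneg _)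
          zero_le_one
    _ ≤ (1 + 2 * K / β) * (P + Mt β b d t * e) := by nlinarith [mul_nonneg hKβ hP]
    _ ≤ (1 + 2 * K / β) * (P + Mt β b d t * c * e) := by
        gcongr
        exact le_mul_of_one_le_right hM0 hcoth

/-! ### Reduction to the eigenvalues of the Galerkin operator -/

theorem resolvent_apply_eigenvector {E : Type*} [AddCommGroup E] [Module ℂ E]
    {T : Module.End ℂ E} {z μ : ℂ} (hz : z ∈ resolventSet ℂ T) {v : E} (hv : v ≠ 0)
    (h : T v = μ • v) : resolvent T z v = (z - μ)⁻¹ • v := by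
  have hunit : IsUnit (algebraMap ℂ (Module.End ℂ E) z - T) := hz
  have h1 : (algebraMap ℂ (Module.End ℂ E) z - T) v = (z - μ) • v := by
    rw [LinearMap.sub_apply, Module.algebraMap_end_apply, h, sub_smul]
  have h2 : resolvent T z ((algebraMap ℂ (Module.End ℂ E) z - T) v) = v := by
    have := Ring.inverse_mul_cancel _ hunit
    exact congrArg (fun S : Module.End ℂ E => S v) this
  have h3 : z - μ ≠ 0 := by
    intro h0
    rw [h1, h0, zero_smul, map_zero] at h2
    exact hv h2.symm
  rw [h1, map_smul] at h2
  rw [eq_inv_smul_iff₀ h3, h2]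

theorem norm_le_of_apply_orthonormalBasis {E ι : Type*} [NormedAddCommGroup E]
    [InnerProductSpace ℂ E] [FiniteDimensional ℂ E] [Fintype ι] (e : OrthonormalBasis ι ℂ E)
    (D : E →ₗ[ℂ] E) {c : ι → ℂ} {C : ℝ} (hC0 : 0 ≤ C) (hD : ∀ j, D (e j) = c j • e j)
    (hc : ∀ j, ‖c j‖ ≤ C) : ‖LinearMap.toContinuousLinearMap D‖ ≤ C := by
  classical
  refine ContinuousLinearMap.opNorm_le_bound _ hC0 fun v => ?_
  rw [LinearMap.coe_toContinuousLinearMap']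
  have hcoef : ∀ j, inner ℂ (e j) (D v) = c j * inner ℂ (e j) v := by
    intro j
    conv_lhs => rw [← e.sum_repr' v]
    simp only [map_sum, map_smul, hD, inner_sum, inner_smul_right,
      orthonormal_iff_ite.1 e.orthonormal]
    simp [mul_comm]
  refine abs_le_of_sq_le_sq' ?_ (by positivity) |>.2
  rw [← e.sum_sq_norm_inner_right (D v), mul_pow, ← e.sum_sq_norm_inner_right v, Finset.mul_sum]
  refine Finset.sum_le_sum fun j _ => ?_
  rw [hcoef, norm_mul, mul_pow]
  have := hc j
  gcongr

section Galerkin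

variable {n : ℕ} {Ω : Set (Euc n)} (A : EllipticForm Ω) (V : Submodule ℂ (L2 Ω))
  [FiniteDimensional ℂ V] (hV : V ≤ H10 Ω)

/-- The eigenvalues of a Galerkin operator are real and at least `λ₁`. -/
theorem galerkinOp_eigenvalue (hΩo : IsOpen Ω) (hΩb : Bornology.IsBounded Ω) {μ : ℂ} {v : V}
    (hv : v ≠ 0) (h : galerkinOp A V hV v = μ • v) : μ.im = 0 ∧ A.lam1 ≤ μ.re := by
  set w : H10 Ω := Submodule.inclusion hV v with hw
  have hwv : (w : L2 Ω) = v := rfl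
  have h0 : 0 < ‖(w : L2 Ω)‖ ^ 2 := by
    have : ‖(w : L2 Ω)‖ ≠ 0 := norm_ne_zero_iff.2 (by rw [hwv]; simpa using hv)
    positivity
  have h1 : A.form w w = μ * ((‖(w : L2 Ω)‖ ^ 2 : ℝ) : ℂ) := by
    rw [hw, ← inner_galerkinOp A V hV, h]
    change inner ℂ (v : L2 Ω) (μ • (v : L2 Ω)) = μ * ((‖(v : L2 Ω)‖ ^ 2 : ℝ) : ℂ)
    rw [inner_smul_right, inner_self_eq_norm_sq_to_K]
    simp
  have him : (A.form w w).im = 0 := by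
    have := congrArg Complex.im (A.hermitian w w)
    rw [Complex.conj_im] at this
    linarith
  have hre := A.lam1_mul_le hΩo hΩb w
  rw [EllipticForm.quad, h1, Complex.re_mul_ofReal] at hre
  rw [h1, Complex.im_mul_ofReal] at him
  exact ⟨(mul_eq_zero.1 him).resolve_right h0.ne', le_of_mul_le_mul_right hre h0⟩

theorem hypContour_mem_resolventSet (hΩo : IsOpen Ω) (hΩb : Bornology.IsBounded Ω) {b : ℝ}
    (hb : 0 < b) (hbl : b < A.lam1) (y : ℝ) :
    hypContour b y ∈ resolventSet ℂ (galerkinOp A V hV) := by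
  by_contra hy
  have hev : Module.End.HasEigenvalue (galerkinOp A V hV) (hypContour b y) :=
    Module.End.hasEigenvalue_iff_mem_spectrum.2 hy
  obtain ⟨v, hv⟩ := hev.exists_hasEigenvector
  obtain ⟨h1, h2⟩ := galerkinOp_eigenvalue A V hV hΩo hΩb hv.2 hv.apply_eq_smul
  rw [(hypContour_ofReal b y).2] at h1
  have h3 : y = 0 := by simpa [hb.ne'] using h1
  rw [(hypContour_ofReal b y).1, h3, Real.cosh_zero] at h2
  linarith

theorem expFrac_apply_eigenvector {T : V →ₗ[ℂ] V} (hT : T.IsSymmetric) (β t : ℝ)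
    (j : Fin (Module.finrank ℂ V)) :
    expFrac V hT β t (hT.eigenvectorBasis rfl j) =
      ((Real.exp (-t * hT.eigenvalues rfl j ^ β) : ℝ) : ℂ) • hT.eigenvectorBasis rfl j := by
  rw [expFrac, LinearMap.sum_apply, Finset.sum_eq_single j]
  · simp
  · intro i _ hij
    have : inner ℂ (hT.eigenvectorBasis rfl i) (hT.eigenvectorBasis rfl j) = 0 :=
      (hT.eigenvectorBasis rfl).orthonormal.2 hij
    simp [this]
  · simp

end Galerkin

end SincQuad

end

theorem theorem4p1 {n : ℕ} (hn : n = 2 ∨ n = 3) (Ω : Set (SincQuad.Euc n))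
    (hΩo : IsOpen Ω) (hΩc : IsConnected Ω) (hΩb : Bornology.IsBounded Ω)
    (A : SincQuad.EllipticForm Ω) (β b d : ℝ) (hβ0 : 0 < β) (hβ1 : β < 1)
    (hb0 : 0 < b) (hb1 : b < A.lam1 / √2) (hd0 : 0 < d) (hd1 : d < Real.pi / 4) :
    (∃ C : ℝ, 0 < C ∧ ∀ (𝒯 : SincQuad.Mesh Ω) (t k : ℝ) (N : ℕ), 0 < t → 0 < k → 1 ≤ N →
      (∀ y : ℝ, SincQuad.hypContour b y ∈ resolventSet ℂ (SincQuad.Lh A 𝒯)) ∧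
      ‖LinearMap.toContinuousLinearMap
          (SincQuad.expLh A 𝒯 β t - SincQuad.sincQuad A 𝒯 β b N k t)‖ ≤
        C * (SincQuad.Ndt β b A.lam1 d t / (Real.exp (2 * Real.pi * d / k) - 1) +
          SincQuad.Mt β b d t * (Real.cosh (k * N) / Real.sinh (k * N)) *
            Real.exp (-(SincQuad.kap β b d) * 2 ^ (-β) * t * Real.exp (k * N * β)))) ∧
    (∀ t : ℝ, 0 < t →
      (∀ lam : ℝ, A.lam1 ≤ lam →
        MeasureTheory.Integrable (fun y : ℝ => SincQuad.gLines β b d lam t y)) ∧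
      IsGreatest (SincQuad.gIntegrals β b A.lam1 d t) (SincQuad.Ndt β b A.lam1 d t)) ∧
    (∀ t₀ : ℝ, 0 < t₀ → ∃ B : ℝ, ∀ t : ℝ, t₀ ≤ t → SincQuad.Ndt β b A.lam1 d t ≤ B) ∧
    (fun t : ℝ => SincQuad.Ndt β b A.lam1 d t) =O[𝓝[>] (0 : ℝ)]
      (fun t : ℝ => SincQuad.Mt β b d t) := by
  have hs2 : 0 < √2 := by positivity
  have hl : √2 * b < A.lam1 := by rwa [lt_div_iff₀ hs2, mul_comm] at hb1
  have hbl : b < A.lam1 := by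
    have h2 : 1 ≤ √2 := Real.one_le_sqrt.2 (by norm_num)
    nlinarith
  have hκ := SincQuad.kap_pos hβ0 hβ1 hb0 hd0 hd1
  obtain ⟨K, hK0, hK⟩ := SincQuad.exists_norm_deriv_hypContour_le hb0 hd0 hd1 hl
  refine ⟨⟨1 + 2 * K / β, by positivity, fun 𝒯 t k N ht hk hN => ?_⟩, fun t ht => ⟨?_, ?_⟩,
    fun t₀ ht₀ => ?_, ?_⟩
  · have hres := SincQuad.hypContour_mem_resolventSet A (SincQuad.femSpace 𝒯)
      (SincQuad.femSpace_le 𝒯) hΩo hΩb hb0 hbl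
    refine ⟨hres, ?_⟩
    set V := SincQuad.femSpace 𝒯
    have hT := SincQuad.galerkinOp_isSymmetric A V (SincQuad.femSpace_le 𝒯)
    set e := hT.eigenvectorBasis rfl with he
    have hrhs := SincQuad.norm_exp_sub_quadrature_le hβ0 hβ1 hb0 hd0 hd1 hl hK0 hK le_rfl ht hk hN
    refine SincQuad.norm_le_of_apply_orthonormalBasis e _ ((norm_nonneg _).trans hrhs)
      (c := fun j => (Real.exp (-t * hT.eigenvalues rfl j ^ β) : ℂ) +
        (k : ℂ) / (2 * Real.pi * Complex.I) * ∑ i ∈ Finset.Icc (-(N : ℤ)) N,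
          SincQuad.gFun β b (hT.eigenvalues rfl j) t ((i : ℂ) * k)) (fun j => ?_) (fun j => ?_)
    · have hej : e j ≠ 0 := e.orthonormal.ne_zero j
      have hTe : SincQuad.Lh A 𝒯 (e j) = ((hT.eigenvalues rfl j : ℝ) : ℂ) • e j :=
        hT.apply_eigenvectorBasis rfl j
      have hexp : SincQuad.expLh A 𝒯 β t (e j) =
          ((Real.exp (-t * hT.eigenvalues rfl j ^ β) : ℝ) : ℂ) • e j :=
        SincQuad.expFrac_apply_eigenvector V hT β t j
      have hquad : SincQuad.sincQuad A 𝒯 β b N k t (e j) =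
          (-((k : ℂ) / (2 * Real.pi * Complex.I) * ∑ i ∈ Finset.Icc (-(N : ℤ)) N,
            SincQuad.gFun β b (hT.eigenvalues rfl j) t ((i : ℂ) * k))) • e j := by
        rw [SincQuad.sincQuad, LinearMap.smul_apply, LinearMap.sum_apply, ← mul_neg, mul_smul,
          ← Finset.sum_neg_distrib, Finset.sum_smul]
        congr 1
        refine Finset.sum_congr rfl fun i _ => ?_
        have hz : SincQuad.hypContour b ((i : ℂ) * k) ∈ resolventSet ℂ (SincQuad.Lh A 𝒯) := by
          have := hres (i * k)
          push_cast at this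
          exact this
        rw [LinearMap.smul_apply, LinearMap.neg_apply,
          SincQuad.resolvent_apply_eigenvector hz hej hTe, SincQuad.gFun, ← neg_smul, smul_smul]
        congr 1
        ring
      rw [LinearMap.sub_apply, hexp, hquad, ← sub_smul, sub_neg_eq_add]
    · have hlam : A.lam1 ≤ hT.eigenvalues rfl j :=
        (SincQuad.galerkinOp_eigenvalue A V (SincQuad.femSpace_le 𝒯) hΩo hΩb
          (e.orthonormal.ne_zero j) (hT.apply_eigenvectorBasis rfl j)).2
      exact SincQuad.norm_exp_sub_quadrature_le hβ0 hβ1 hb0 hd0 hd1 hl hK0 hK hlam ht hk hN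
  · exact fun lam hlam => SincQuad.integrable_gLines hβ0 hβ1 hb0 hd0 hd1 hK ht hlam
  · exact SincQuad.isGreatest_Ndt hβ0 hβ1 hb0 hd0 hd1 hK ht
  · refine ⟨4 * K / β * SincQuad.Mt β b d t₀, fun t ht => ?_⟩
    have ht0 : 0 < t := ht₀.trans_le ht
    refine (SincQuad.Ndt_le hβ0 hβ1 hb0 hd0 hd1 hK hK0 ht0).trans ?_
    gcongr
    exact SincQuad.Mt_antitoneOn hκ ht₀ ht0 ht
  · refine .of_bound (4 * K / β) ?_
    filter_upwards [self_mem_nhdsWithin] with t ht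
    rw [Real.norm_of_nonneg (SincQuad.Ndt_nonneg hβ0 hβ1 hb0 hd0 hd1 hK ht)]
    refine (SincQuad.Ndt_le hβ0 hβ1 hb0 hd0 hd1 hK hK0 ht).trans ?_
    gcongr
    exact Real.le_norm_self _
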